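/- Let $\alpha>0$, $\beta>0$ satisfy $\min\{\alpha+3\beta,\,3\alpha+\beta\}>4\alpha\beta$, and let $\theta_0\in L^2(\mathbb{R}^2)$ be real-valued. Write $\Lambda_{x_j}^{s}$ for the Fourier multiplier on $\mathbb{R}^2$ with symbol $|\xi_j|^{s}$ (frequency normalized so that $\partial_{x_j}$ has symbol $i\xi_j$) and $\mathcal{R}_j=\partial_{x_j}(-\Delta)^{-1/2}$ for the Riesz transforms. Consider the surface quasi-geostrophic equation with anisotropic fractional dissipation $$\partial_t\theta+(u\cdot\nabla)\theta+\Lambda_{x_1}^{2\alpha}\theta+\Lambda_{x_2}^{2\beta}\theta=0,\qquad u=(-\mathcal{R}_2\theta,\ \mathcal{R}_1\theta),\qquad \theta(\cdot,0)=\theta_0, \tag{1}$$ and its linear part $$\partial_t\widetilde\theta+\Lambda_{x_1}^{2\alpha}\widetilde\theta+\Lambda_{x_2}^{2\beta}\widetilde\theta=0,\qquad \widetilde\theta(\cdot,0)=\theta_0. \tag{2}$$ A (global, Leray-type) weak solution of (1) is a (strongly measurable) map $\theta:[0,\infty)\to L^2(\mathbb{R}^2)$, with real-valued $\theta(t)$,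 such that for every Schwartz function $\varphi$ and every $t\ge 0$ $$\int\theta(t)\varphi\,dx-\int\theta_0\varphi\,dx=\int_0^t\!\!\int\theta\,\big(u\cdot\nabla\varphi-\Lambda_{x_1}^{2\alpha}\varphi-\Lambda_{x_2}^{2\beta}\varphi\big)\,dx\,ds,$$ and such that, for $s=0$ and for almost every $s>0$, the energy inequality $$\|\theta(t)\|_{L^2}^2+2\int_s^t\big(\|\Lambda_{x_1}^{\alpha}\theta(\tau)\|_{L^2}^2+\|\Lambda_{x_2}^{\beta}\theta(\tau)\|_{L^2}^2\big)\,d\tau\le\|\theta(s)\|_{L^2}^2\qquad\text{for all }t\ge s$$ holds (with $\theta(0)=\theta_0$). A solution of (2) is a (strongly measurable) map $\widetilde\theta:[0,\infty)\to L^2(\mathbb{R}^2)$, with real-valued $\widetilde\theta(t)$, bounded on bounded time intervals, that satisfies the same integral identity without the term $u\cdot\nabla\varphi$. Then there is a constant $C_0>0$, depending only on $\alpha$, $\beta$ and $\theta_0$, such that for every weak solution $\theta$ of (1) and every solution $\widetilde\theta$ of (2) $$\|\theta(t)-\widetilde\theta(t)\|_{L^2}\le C_0(1+t)^{-\frac{\min\{\alpha+3\beta,\,3\alpha+\beta\}-4\alpha\beta}{8\alpha\beta}}\qquad\text{for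 all }t\ge 0.$$ -/

import Mathlib

open MeasureTheory FourierTransform SchwartzMap
open scoped ENNReal

noncomputable section

namespace AnisoSQG

/-- The plane `ℝ²` with its Euclidean norm; the coordinates `x₁, x₂` are `x 0, x 1`. -/
abbrev Plane : Type := EuclideanSpace ℝ (Fin 2)

/-- Real-valued `L²(ℝ²)`. -/
abbrev RealL2 : Type := Lp ℝ 2 (volume : Measure Plane)

/-- Complex-valued `L²(ℝ²)`. -/
abbrev ComplexL2 : Type := Lp ℂ 2 (volume : Measure Plane)

/-- A real-valued `L²` function regarded as a complex-valued one. -/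
def toComplex (f : RealL2) : ComplexL2 := Complex.ofRealCLM.compLp f

open Classical in
/-- The Fourier multiplier operator with symbol `m` on `L²(ℝ²)`, that is `𝓕⁻¹ (m · 𝓕 f)`, with
domain the set of `f` such that `m · 𝓕 f` is square integrable (outside the domain the value is
the junk value `0`). Here `𝓕` is the unitary Fourier transform with kernel `e^{-2πi x·ξ}`, so that
`∂ⱼ` has the symbol `2πi ξⱼ`. -/
def fourierMultiplier (m : Plane → ℂ) (f : ComplexL2) : ComplexL2 :=
  if h : MemLp (fun ξ => m ξ * 𝓕 f ξ) 2 (volume : Measure Plane) then 𝓕⁻ (h.toLp _) else 0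

/-- The symbol of `Λ_{xⱼ}^s = (-∂ⱼ²)^{s/2}`. -/
def absDerivSymbol (j : Fin 2) (s : ℝ) (ξ : Plane) : ℝ := (2 * Real.pi * |ξ j|) ^ s

/-- The operator `Λ_{xⱼ}^s` on `L²(ℝ²)`. -/
def absDeriv (j : Fin 2) (s : ℝ) (f : ComplexL2) : ComplexL2 :=
  fourierMultiplier (fun ξ => (absDerivSymbol j s ξ : ℂ)) f

/-- The symbol of the Riesz transform `Rⱼ = ∂ⱼ Λ⁻¹`. -/
def rieszSymbol (j : Fin 2) (ξ : Plane) : ℂ := Complex.I * ((ξ j / ‖ξ‖ : ℝ) : ℂ)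

/-- The Riesz transform `Rⱼ = ∂ⱼ Λ⁻¹` on `L²(ℝ²)`. -/
def riesz (j : Fin 2) (f : ComplexL2) : ComplexL2 := fourierMultiplier (rieszSymbol j) f

/-- The squared norm `‖Λ_{xⱼ}^s f‖²_{L²}`, computed on the Fourier side by Plancherel's theorem,
with the value `∞` when `f` is not in the domain of `Λ_{xⱼ}^s`. -/
def absDerivNormSq (j : Fin 2) (s : ℝ) (f : RealL2) : ℝ≥0∞ :=
  ∫⁻ ξ : Plane, ‖(absDerivSymbol j s ξ : ℂ) * 𝓕 (toComplex f) ξ‖ₑ ^ 2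

lemma measurable_absDerivSymbol (j : Fin 2) (s : ℝ) : Measurable (absDerivSymbol j s) := by
  unfold absDerivSymbol
  fun_prop

lemma measurable_rieszSymbol (j : Fin 2) : Measurable (rieszSymbol j) := by
  unfold rieszSymbol
  fun_prop

/-- The Riesz transforms are everywhere defined on `L²`. -/
lemma memLp_riesz (j : Fin 2) (f : ComplexL2) :
    MemLp (fun ξ => rieszSymbol j ξ * 𝓕 f ξ) 2 (volume : Measure Plane) := by
  refine MemLp.of_le (Lp.memLp (𝓕 f))
    ((measurable_rieszSymbol j).aestronglyMeasurable.mul (Lp.aestronglyMeasurable _))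
    (Filter.Eventually.of_forall fun ξ => ?_)
  have h : ‖rieszSymbol j ξ‖ ≤ 1 := by
    have h1 : |ξ j| ≤ ‖ξ‖ := by simpa using PiLp.norm_apply_le ξ j
    simp only [rieszSymbol, norm_mul, Complex.norm_I, one_mul, Complex.norm_real,
      Real.norm_eq_abs, abs_div, abs_norm]
    exact div_le_one_of_le₀ h1 (norm_nonneg _)
  calc ‖rieszSymbol j ξ * 𝓕 f ξ‖ = ‖rieszSymbol j ξ‖ * ‖𝓕 f ξ‖ := norm_mul _ _
    _ ≤ 1 * ‖𝓕 f ξ‖ := by gcongr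
    _ = ‖𝓕 f ξ‖ := one_mul _

/-- Schwartz functions are in the domain of `Λ_{xⱼ}^s` for every `s ≥ 0`. -/
lemma memLp_absDeriv_schwartz (j : Fin 2) {s : ℝ} (hs : 0 ≤ s) (φ : 𝓢(Plane, ℂ)) :
    MemLp (fun ξ => (absDerivSymbol j s ξ : ℂ) * 𝓕 (φ.toLp 2 : ComplexL2) ξ) 2
      (volume : Measure Plane) := by
  obtain ⟨N, hN⟩ := exists_nat_ge s
  have hg : Function.HasTemperateGrowth (fun ξ : Plane => (1 + ‖ξ‖ ^ 2 : ℝ) ^ N) := by fun_prop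
  have hψ := ((smulLeftCLM ℂ (fun ξ : Plane => (1 + ‖ξ‖ ^ 2 : ℝ) ^ N) (𝓕 φ)).memLp 2
    (volume : Measure Plane)).const_mul (((4 * Real.pi) ^ s : ℝ) : ℂ)
  refine MemLp.of_le hψ ((Complex.measurable_ofReal.comp
    (measurable_absDerivSymbol j s)).aestronglyMeasurable.mul (Lp.aestronglyMeasurable _)) ?_
  have hae : ((𝓕 (φ.toLp 2 : ComplexL2) : ComplexL2) : Plane → ℂ) =ᵐ[volume]
      ((𝓕 φ : 𝓢(Plane, ℂ)) : Plane → ℂ) := by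
    rw [SchwartzMap.toLp_fourier_eq]
    exact SchwartzMap.coeFn_toLp _ _ _
  filter_upwards [hae] with ξ hξ
  rw [hξ, norm_mul, norm_mul, smulLeftCLM_apply_apply hg, norm_smul, ← mul_assoc]
  gcongr
  have h1 : |ξ j| ≤ ‖ξ‖ := by simpa using PiLp.norm_apply_le ξ j
  have h2 : ‖ξ‖ ≤ 1 + ‖ξ‖ ^ 2 := by nlinarith [sq_nonneg (‖ξ‖ - 1), norm_nonneg ξ]
  have h3 : (1 : ℝ) ≤ 1 + ‖ξ‖ ^ 2 := by nlinarith [sq_nonneg ‖ξ‖]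
  have hpi := Real.pi_pos
  rw [Complex.norm_real, Complex.norm_real, Real.norm_of_nonneg (by unfold absDerivSymbol; positivity),
    Real.norm_of_nonneg (by positivity), Real.norm_of_nonneg (by positivity), absDerivSymbol]
  calc (2 * Real.pi * |ξ j|) ^ s ≤ (4 * Real.pi * (1 + ‖ξ‖ ^ 2)) ^ s := by
        apply Real.rpow_le_rpow (by positivity) _ hs
        nlinarith [abs_nonneg (ξ j)]
    _ = (4 * Real.pi) ^ s * (1 + ‖ξ‖ ^ 2) ^ s := Real.mul_rpow (by positivity) (by positivity)
    _ ≤ (4 * Real.pi) ^ s * (1 + ‖ξ‖ ^ 2) ^ N := by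
        gcongr
        exact (Real.rpow_le_rpow_of_exponent_le h3 hN).trans_eq (Real.rpow_natCast _ _)

/-- On its domain, `absDerivNormSq` is the square of the `L²` norm of `Λ_{xⱼ}^s f`. -/
lemma absDerivNormSq_eq (j : Fin 2) (s : ℝ) (f : RealL2)
    (h : MemLp (fun ξ => (absDerivSymbol j s ξ : ℂ) * 𝓕 (toComplex f) ξ) 2
      (volume : Measure Plane)) :
    absDerivNormSq j s f = ‖absDeriv j s (toComplex f)‖ₑ ^ 2 := by
  have e : ‖absDeriv j s (toComplex f)‖ₑ = ‖h.toLp _‖ₑ := by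
    rw [absDeriv, fourierMultiplier, dif_pos h, ← ofReal_norm, ← ofReal_norm,
      ← Lp.norm_fourier_eq, FourierTransform.fourier_fourierInv_eq]
  rw [e, Lp.enorm_toLp, eLpNorm_eq_lintegral_rpow_enorm_toReal (by norm_num) (by norm_num),
    absDerivNormSq]
  simp only [ENNReal.toReal_ofNat, ENNReal.rpow_ofNat, ← ENNReal.rpow_natCast]
  rw [← ENNReal.rpow_mul]
  norm_num

/-- The velocity `u = R^⊥ θ = (-R₂ θ, R₁ θ)`. -/
def velocity (θ : RealL2) : Fin 2 → ComplexL2 :=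
  ![-riesz 1 (toComplex θ), riesz 0 (toComplex θ)]

/-- The weak form `∫ θ u · ∇φ` of the transport term, where `u = R^⊥ θ`. -/
def transportPairing (θ : RealL2) (φ : 𝓢(Plane, ℂ)) : ℂ :=
  ∫ x : Plane, (θ x : ℂ) *
    ∑ j : Fin 2, velocity θ j x * fderiv ℝ φ x (EuclideanSpace.single j 1)

/-- The weak form `∫ θ (Λ_{x₁}^{2α} φ + Λ_{x₂}^{2β} φ)` of the dissipation term. -/
def dissipationPairing (α β : ℝ) (θ : RealL2) (φ : 𝓢(Plane, ℂ)) : ℂ :=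
  ∫ x : Plane, (θ x : ℂ) *
    (absDeriv 0 (2 * α) (φ.toLp 2) x + absDeriv 1 (2 * β) (φ.toLp 2) x)

/-- Global weak solutions (of Leray type) of
`∂ₜθ + u · ∇θ + Λ_{x₁}^{2α} θ + Λ_{x₂}^{2β} θ = 0`, `u = R^⊥ θ`, `θ(0) = θ₀`, with `θ₀ ∈ L²`:
the equation holds in the sense of distributions, integrated in time, and the energy inequality
holds on `[s, t]` for `s = 0`, for almost every `s > 0`, and for all `t ≥ s`. Only the values of `θ`
at nonnegative times matter. -/
structure IsWeakSolution (α β : ℝ) (θ₀ : RealL2) (θ : ℝ → RealL2) : Prop where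
  measurable : AEStronglyMeasurable θ (volume.restrict (Set.Ioi (0 : ℝ)))
  equation : ∀ (φ : 𝓢(Plane, ℂ)) (t : ℝ), 0 ≤ t →
    (∫ x : Plane, (θ t x : ℂ) * φ x) - ∫ x : Plane, (θ₀ x : ℂ) * φ x =
      ∫ s in (0 : ℝ)..t, (transportPairing (θ s) φ - dissipationPairing α β (θ s) φ)
  energy_zero : ∀ t : ℝ, 0 ≤ t →
    ‖θ t‖ₑ ^ 2 + 2 * ∫⁻ τ in Set.Ioc 0 t, (absDerivNormSq 0 α (θ τ) + absDerivNormSq 1 β (θ τ))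
      ≤ ‖θ₀‖ₑ ^ 2
  energy_ae : ∀ᵐ s ∂(volume.restrict (Set.Ioi (0 : ℝ))), ∀ t : ℝ, s ≤ t →
    ‖θ t‖ₑ ^ 2 + 2 * ∫⁻ τ in Set.Ioc s t, (absDerivNormSq 0 α (θ τ) + absDerivNormSq 1 β (θ τ))
      ≤ ‖θ s‖ₑ ^ 2

/-- Weak solutions, locally bounded in time with values in `L²`, of the linear equation
`∂ₜθ + Λ_{x₁}^{2α} θ + Λ_{x₂}^{2β} θ = 0`, `θ(0) = θ₀`. -/
structure IsLinearSolution (α β : ℝ) (θ₀ : RealL2) (θ : ℝ → RealL2) : Prop where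
  measurable : AEStronglyMeasurable θ (volume.restrict (Set.Ioi (0 : ℝ)))
  locally_bounded : ∀ T : ℝ, ∃ M : ℝ, ∀ t ∈ Set.Icc 0 T, ‖θ t‖ ≤ M
  equation : ∀ (φ : 𝓢(Plane, ℂ)) (t : ℝ), 0 ≤ t →
    (∫ x : Plane, (θ t x : ℂ) * φ x) - ∫ x : Plane, (θ₀ x : ℂ) * φ x =
      -∫ s in (0 : ℝ)..t, dissipationPairing α β (θ s) φ

end AnisoSQG

end

/-!
Let `V` be the (conjugate) Fourier transform of the weak solution and `m` the symbol of the
dissipation. By uniqueness of weak solutions of linear equations, `V` is given by Duhamel's formula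
with the transport term `N` as forcing, and the linear solution is `e^{-tm} V₀`; it remains to bound
`W = V - e^{-tm} V₀`, the Duhamel integral of `N`. Since the transport term is a divergence and
`θ u` is bounded in `L¹`, `|N(t, ξ)| ≤ C |ξ|`.

The difference `|V|² - |W|²` satisfies an energy balance whose only source is the work of `N`
against the linear flow `e^{-tm} V₀`. By Cauchy–Schwarz this work is at most `‖V₀‖` times the `L²`
norm of `C |ξ| e^{-tm}`, which is `O(t^{-γ-1})` for `γ = (min (α + 3β) (3α + β) - 4αβ) / (4αβ)`. So
`W` inherits the energy inequality of `V` up to an integrable error. Splitting the frequencies at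
`m ∼ 1 / t`, where `|W(t, ξ)| ≤ C t |ξ|` controls the low ones, gives
`(1 + K) ‖W(t)‖² ≤ ‖W(s)‖² + O(t^{-γ})` for some `s ∈ [t/4, t/2]` and `K = 4^γ`, and iterating over
dyadic times `‖W(t)‖² = O(t^{-γ})`.
-/

noncomputable section

namespace AnisoSQG

open scoped ContDiff

section FundamentalTheorem

variable {F : Type*} [NormedAddCommGroup F] [NormedSpace ℝ F]

lemma absolutelyContinuousOnInterval_primitive {k : ℝ → F}
    (hk : ∀ x y : ℝ, IntervalIntegrable k volume x y) (a s t : ℝ) :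
    AbsolutelyContinuousOnInterval (fun x => ∫ r in a..x, k r) s t := by
  have hac := (hk s t).norm.absolutelyContinuousOnInterval_intervalIntegral (c := s) (by simp)
  refine squeeze_zero (fun I => by positivity) (fun I => ?_) hac
  gcongr with i
  rw [dist_eq_norm, dist_eq_norm,
    intervalIntegral.integral_interval_sub_left (hk _ _) (hk _ _),
    intervalIntegral.integral_interval_sub_left (hk _ _).norm (hk _ _).norm]
  exact intervalIntegral.norm_integral_le_abs_integral_norm

lemma integral_eq_sub_of_ae_hasDerivAt [CompleteSpace F] {f f' : ℝ → F} {s t : ℝ}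
    (hf : AbsolutelyContinuousOnInterval f s t)
    (hf' : ∀ᵐ x, x ∈ Set.uIcc s t → HasDerivAt f (f' x) x)
    (hint : ∀ x y : ℝ, IntervalIntegrable f' volume x y) : ∫ x in s..t, f' x = f t - f s := by
  have hzero : ∀ᵐ x, x ∈ Set.uIcc s t →
      HasDerivAt (fun x => f x - ∫ r in s..x, f' r) 0 x := by
    filter_upwards [hf', (hint s t).ae_hasDerivAt_integral] with x hx hprim hxs
    simpa using! (hx hxs).sub (hprim hxs s (by simp))
  obtain ⟨c, hc⟩ := (hf.fun_sub
    (absolutelyContinuousOnInterval_primitive hint s s t)).const_of_ae_hasDerivAt_zero hzero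
  have hs := hc s (by simp)
  rw [intervalIntegral.integral_same, sub_zero] at hs
  rw [hs, ← hc t (by simp), sub_sub_cancel]

end FundamentalTheorem

/-- The solution of `∂ₜ X = N - m X`, `X(0) = X₀`, given by Duhamel's formula. In the applications
the variable `ξ` is a frequency. -/
def duhamel {Ω F : Type*} [NormedAddCommGroup F] [NormedSpace ℝ F] (m : Ω → ℝ) (N : ℝ → Ω → F)
    (X₀ : Ω → F) (t : ℝ) (ξ : Ω) : F :=
  Real.exp (-(m ξ * t)) • (X₀ ξ + ∫ σ in (0 : ℝ)..t, Real.exp (m ξ * σ) • N σ ξ)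

/-- A jointly measurable forcing term `N`, dominated by the weight `w` at all times. -/
structure IsForcing {Ω F : Type*} [MeasurableSpace Ω] [NormedAddCommGroup F] (w : Ω → ℝ)
    (N : ℝ → Ω → F) : Prop where
  stronglyMeasurable : StronglyMeasurable (Function.uncurry N)
  norm_le : ∀ s ξ, ‖N s ξ‖ ≤ w ξ

section Forcing

variable {Ω F : Type*} [MeasurableSpace Ω] [NormedAddCommGroup F] {w : Ω → ℝ} {N : ℝ → Ω → F}

lemma IsForcing.weight_nonneg (hN : IsForcing w N) (ξ : Ω) : 0 ≤ w ξ :=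
  (norm_nonneg _).trans (hN.norm_le 0 ξ)

lemma IsForcing.intervalIntegrable (hN : IsForcing w N) (ξ : Ω) (x y : ℝ) :
    IntervalIntegrable (fun σ => N σ ξ) volume x y :=
  (intervalIntegrable_const (c := w ξ)).mono_fun
    (hN.stronglyMeasurable.comp_measurable measurable_prodMk_right).aestronglyMeasurable
    (.of_forall fun σ => (hN.norm_le σ ξ).trans (le_abs_self _))

end Forcing

section Duhamel

variable {Ω F : Type*} [NormedAddCommGroup F] [NormedSpace ℝ F] {m w : Ω → ℝ} {N : ℝ → Ω → F}
  {X₀ : Ω → F}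

lemma duhamel_zero_time (ξ : Ω) : duhamel m N X₀ 0 ξ = X₀ ξ := by
  simp [duhamel]

/-- The solution `e^{-tm} X₀` of `∂ₜ X = -m X`, `X(0) = X₀`. -/
def linearFlow (m : Ω → ℝ) (X₀ : Ω → F) (t : ℝ) (ξ : Ω) : F :=
  Real.exp (-(m ξ * t)) • X₀ ξ

lemma duhamel_zero_forcing (t : ℝ) (ξ : Ω) : duhamel m 0 X₀ t ξ = linearFlow m X₀ t ξ := by
  simp [duhamel, linearFlow]

lemma duhamel_eq_add (t : ℝ) (ξ : Ω) :
    duhamel m N X₀ t ξ = linearFlow m X₀ t ξ + duhamel m N 0 t ξ := by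
  simp only [duhamel, linearFlow, smul_add, Pi.zero_apply, zero_add]

lemma norm_linearFlow_le (hm0 : ∀ ξ, 0 ≤ m ξ) {s t : ℝ} (hst : s ≤ t) (ξ : Ω) :
    ‖linearFlow m X₀ t ξ‖ ≤ ‖linearFlow m X₀ s ξ‖ := by
  have := hm0 ξ
  rw [linearFlow, linearFlow, norm_smul, norm_smul, Real.norm_of_nonneg (Real.exp_pos _).le,
    Real.norm_of_nonneg (Real.exp_pos _).le]
  gcongr

lemma linearFlow_zero_time (ξ : Ω) : linearFlow m X₀ 0 ξ = X₀ ξ := by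
  simp [linearFlow]

section IntervalIntegrable

variable {ξ : Ω} (hN : ∀ x y : ℝ, IntervalIntegrable (fun σ => N σ ξ) volume x y)
include hN

lemma intervalIntegrable_exp_smul (a x y : ℝ) :
    IntervalIntegrable (fun σ => Real.exp (a * σ) • N σ ξ) volume x y :=
  (hN x y).continuousOn_smul (by fun_prop)

lemma continuous_duhamel : Continuous fun t => duhamel m N X₀ t ξ := by
  have := intervalIntegral.continuous_primitive (intervalIntegrable_exp_smul hN (m ξ)) 0
  unfold duhamel
  fun_prop

lemma duhamel_sub [CompleteSpace F] (s t : ℝ) :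
    duhamel m N X₀ t ξ - duhamel m N X₀ s ξ =
      ∫ σ in s..t, (N σ ξ - m ξ • duhamel m N X₀ σ ξ) := by
  set I : ℝ → F := fun t => X₀ ξ + ∫ σ in (0 : ℝ)..t, Real.exp (m ξ * σ) • N σ ξ with hI
  have hint := intervalIntegrable_exp_smul hN (m ξ)
  have hac : AbsolutelyContinuousOnInterval (fun t => duhamel m N X₀ t ξ) s t := by
    refine AbsolutelyContinuousOnInterval.fun_smul (f := fun t => Real.exp (-(m ξ * t)))
      (g := I) (ContDiffOn.absolutelyContinuousOnInterval (by fun_prop)) ?_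
    exact (ContDiffOn.absolutelyContinuousOnInterval (by fun_prop)).fun_add
      (absolutelyContinuousOnInterval_primitive hint 0 s t)
  refine (integral_eq_sub_of_ae_hasDerivAt (f' := fun σ => N σ ξ - m ξ • duhamel m N X₀ σ ξ) hac ?_
    fun x y => (hN x y).sub (((continuous_duhamel hN).const_smul _).intervalIntegrable x y)).symm
  filter_upwards [(hint s t).ae_hasDerivAt_integral] with x hx hxs
  have hexp : HasDerivAt (fun t => Real.exp (-(m ξ * t))) (Real.exp (-(m ξ * x)) * -m ξ) x := by
    simpa using ((hasDerivAt_id x).const_mul (m ξ)).neg.exp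
  have hIx : HasDerivAt I (Real.exp (m ξ * x) • N x ξ) x := by
    refine ((hx hxs s (by simp)).const_add (I s)).congr_of_eventuallyEq (.of_forall fun y => ?_)
    simp only [hI, add_assoc,
      intervalIntegral.integral_add_adjacent_intervals (hint _ _) (hint _ _)]
  refine (hexp.smul hIx).congr_deriv ?_
  rw [smul_smul, ← Real.exp_add, neg_add_cancel, Real.exp_zero, one_smul, duhamel, sub_eq_add_neg,
    ← neg_smul, smul_smul, mul_comm (-m ξ)]

end IntervalIntegrable

variable [MeasurableSpace Ω]

lemma IsForcing.norm_duhamel_le (hN : IsForcing w N) (hm0 : ∀ ξ, 0 ≤ m ξ) {t : ℝ} (ht : 0 ≤ t)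
    (ξ : Ω) : ‖duhamel m N X₀ t ξ‖ ≤ ‖X₀ ξ‖ + w ξ * t := by
  have hexp : Real.exp (-(m ξ * t)) ≤ 1 :=
    Real.exp_le_one_iff.mpr (neg_nonpos.mpr (mul_nonneg (hm0 ξ) ht))
  have hint : ‖∫ σ in (0 : ℝ)..t, Real.exp (m ξ * σ) • N σ ξ‖ ≤
      Real.exp (m ξ * t) * w ξ * |t - 0| := by
    refine intervalIntegral.norm_integral_le_of_norm_le_const fun σ hσ => ?_
    rw [Set.uIoc_of_le ht] at hσ
    rw [norm_smul, Real.norm_of_nonneg (Real.exp_pos _).le]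
    have := hm0 ξ
    gcongr
    · exact hσ.2
    · exact hN.norm_le σ ξ
  calc ‖duhamel m N X₀ t ξ‖
      ≤ Real.exp (-(m ξ * t)) * (‖X₀ ξ‖ + Real.exp (m ξ * t) * w ξ * |t - 0|) := by
        rw [duhamel, norm_smul, Real.norm_of_nonneg (Real.exp_pos _).le]
        gcongr
        exact norm_add_le_of_le le_rfl hint
    _ = Real.exp (-(m ξ * t)) * ‖X₀ ξ‖ + w ξ * t := by
        rw [sub_zero, abs_of_nonneg ht, Real.exp_neg]
        field_simp
    _ ≤ ‖X₀ ξ‖ + w ξ * t := by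
        gcongr
        exact mul_le_of_le_one_left (norm_nonneg _) hexp

lemma IsForcing.stronglyMeasurable_duhamel_zero (hN : IsForcing w N) (hm : Measurable m) :
    StronglyMeasurable (Function.uncurry (duhamel m N 0)) := by
  refine stronglyMeasurable_uncurry_of_continuous_of_stronglyMeasurable
    (fun ξ => continuous_duhamel (hN.intervalIntegrable ξ)) fun t => ?_
  have hint : StronglyMeasurable (Function.uncurry fun ξ σ => Real.exp (m ξ * σ) • N σ ξ) :=
    (by fun_prop : Measurable fun p : Ω × ℝ => Real.exp (m p.1 * p.2)).stronglyMeasurable.smul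
      (hN.stronglyMeasurable.comp_measurable measurable_swap)
  have hexp : Measurable fun ξ => Real.exp (-(m ξ * t)) := by fun_prop
  exact hexp.stronglyMeasurable.smul
    (stronglyMeasurable_zero.add (hint.integral_prod_right.sub hint.integral_prod_right))

lemma aestronglyMeasurable_linearFlow (hm : Measurable m) {μ : Measure Ω}
    (hX₀ : AEStronglyMeasurable X₀ μ) (ν : Measure ℝ) :
    AEStronglyMeasurable (Function.uncurry (linearFlow m X₀)) (ν.prod μ) := by
  have hexp : Measurable fun p : ℝ × Ω => Real.exp (-(m p.2 * p.1)) := by fun_prop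
  exact hexp.aestronglyMeasurable.smul hX₀.comp_snd

lemma aestronglyMeasurable_linearFlow_apply (hm : Measurable m) {μ : Measure Ω}
    (hX₀ : AEStronglyMeasurable X₀ μ) (t : ℝ) : AEStronglyMeasurable (linearFlow m X₀ t) μ := by
  have hexp : Measurable fun ξ => Real.exp (-(m ξ * t)) := by fun_prop
  exact hexp.aestronglyMeasurable.smul hX₀

lemma IsForcing.aestronglyMeasurable_duhamel (hN : IsForcing w N) (hm : Measurable m)
    {μ : Measure Ω} (hX₀ : AEStronglyMeasurable X₀ μ) (ν : Measure ℝ) :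
    AEStronglyMeasurable (Function.uncurry (duhamel m N X₀)) (ν.prod μ) :=
  ((aestronglyMeasurable_linearFlow hm hX₀ ν).add
    (hN.stronglyMeasurable_duhamel_zero hm).aestronglyMeasurable).congr
    (.of_forall fun p => (duhamel_eq_add p.1 p.2).symm)

lemma IsForcing.aestronglyMeasurable_duhamel_apply (hN : IsForcing w N) (hm : Measurable m)
    {μ : Measure Ω} (hX₀ : AEStronglyMeasurable X₀ μ) (t : ℝ) :
    AEStronglyMeasurable (duhamel m N X₀ t) μ :=
  ((aestronglyMeasurable_linearFlow_apply hm hX₀ t).add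
    ((hN.stronglyMeasurable_duhamel_zero hm).comp_measurable
      measurable_prodMk_left).aestronglyMeasurable).congr
    (.of_forall fun ξ => (duhamel_eq_add t ξ).symm)

end Duhamel

/-- The symbol of the dissipation `Λ_{x₁}^{2α} + Λ_{x₂}^{2β}`. -/
def dissipationSymbol (α β : ℝ) (ξ : Plane) : ℝ :=
  absDerivSymbol 0 (2 * α) ξ + absDerivSymbol 1 (2 * β) ξ

lemma dissipationSymbol_nonneg (α β : ℝ) (ξ : Plane) : 0 ≤ dissipationSymbol α β ξ := by
  unfold dissipationSymbol absDerivSymbol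
  positivity

lemma continuous_dissipationSymbol {α β : ℝ} (hα : 0 ≤ α) (hβ : 0 ≤ β) :
    Continuous (dissipationSymbol α β) := by
  unfold dissipationSymbol absDerivSymbol
  exact (Continuous.rpow_const (by fun_prop) fun _ => .inr (by positivity)).add
    (Continuous.rpow_const (by fun_prop) fun _ => .inr (by positivity))

/-- The function `|x|^q` weighted by the kernel of the one-dimensional semigroup `e^{-τ Λ^p}`
on the Fourier side. -/
def semigroupWeight (p q τ x : ℝ) : ℝ :=
  |x| ^ q * Real.exp (-(τ * (2 * Real.pi * |x|) ^ p))

lemma semigroupWeight_eq (p q τ x : ℝ) : semigroupWeight p q τ x =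
    |x| ^ q * Real.exp (-((2 * Real.pi) ^ p * τ) * |x| ^ p) := by
  rw [semigroupWeight, Real.mul_rpow (by positivity) (abs_nonneg x)]
  ring_nf

lemma integrable_semigroupWeight {p q τ : ℝ} (hp : 0 < p) (hq : -1 < q) (hτ : 0 < τ) :
    Integrable (semigroupWeight p q τ) := by
  have := Real.pi_pos
  rw [funext (semigroupWeight_eq p q τ)]
  simpa using! (integrable_fun_norm_addHaar (volume : Measure ℝ)
    (f := fun x : ℝ => x ^ q * Real.exp (-((2 * Real.pi) ^ p * τ) * x ^ p))).mpr (by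
      simpa using integrableOn_rpow_mul_exp_neg_mul_rpow hq hp (by positivity))

lemma exists_integral_semigroupWeight_eq {p q : ℝ} (hp : 0 < p) (hq : -1 < q) :
    ∃ c : ℝ, 0 ≤ c ∧ ∀ τ : ℝ, 0 < τ →
      ∫ x, semigroupWeight p q τ x = c * τ ^ (-((q + 1) / p)) := by
  have := Real.pi_pos
  have hΓ : 0 ≤ Real.Gamma ((q + 1) / p) :=
    Real.Gamma_nonneg_of_nonneg (div_nonneg (by linarith) hp.le)
  refine ⟨2 * (((2 * Real.pi) ^ p) ^ (-(q + 1) / p) * (1 / p) * Real.Gamma ((q + 1) / p)),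
    by positivity, fun τ hτ => ?_⟩
  simp only [semigroupWeight_eq]
  rw [integral_comp_abs (f := fun x => x ^ q * Real.exp (-((2 * Real.pi) ^ p * τ) * x ^ p)),
    integral_rpow_mul_exp_neg_mul_rpow hp hq (by positivity),
    Real.mul_rpow (by positivity) hτ.le, neg_div]
  ring

lemma measurePreserving_coords :
    MeasurePreserving (fun ξ : Plane => (ξ 0, ξ 1)) volume volume :=
  (volume_preserving_finTwoArrow ℝ).comp (PiLp.volume_preserving_ofLp (Fin 2))

lemma measurableEmbedding_coords :
    MeasurableEmbedding (fun ξ : Plane => (ξ 0, ξ 1)) :=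
  (MeasurableEquiv.finTwoArrow (α := ℝ)).measurableEmbedding.comp
    (MeasurableEquiv.toLp 2 (Fin 2 → ℝ)).symm.measurableEmbedding

lemma norm_sq_mul_exp_dissipationSymbol (α β τ : ℝ) (ξ : Plane) :
    ‖ξ‖ ^ 2 * Real.exp (-(τ * dissipationSymbol α β ξ)) =
      semigroupWeight (2 * α) 2 τ (ξ 0) * semigroupWeight (2 * β) 0 τ (ξ 1) +
        semigroupWeight (2 * α) 0 τ (ξ 0) * semigroupWeight (2 * β) 2 τ (ξ 1) := by
  simp only [EuclideanSpace.norm_sq_eq, Fin.sum_univ_two, dissipationSymbol, absDerivSymbol,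
    semigroupWeight, Real.norm_eq_abs, mul_add, neg_add, Real.exp_add, Real.rpow_zero,
    Real.rpow_two]
  ring

section GradientDecay

variable {α β : ℝ}

lemma integrable_norm_sq_mul_exp_dissipationSymbol (hα : 0 < α) (hβ : 0 < β) {τ : ℝ}
    (hτ : 0 < τ) :
    Integrable fun ξ : Plane => ‖ξ‖ ^ 2 * Real.exp (-(τ * dissipationSymbol α β ξ)) := by
  have hint {γ q : ℝ} (hγ : 0 < γ) (hq : 0 ≤ q) : Integrable (semigroupWeight (2 * γ) q τ) :=
    integrable_semigroupWeight (by positivity) (by linarith) hτ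
  simp only [norm_sq_mul_exp_dissipationSymbol]
  exact measurePreserving_coords.integrable_comp_of_integrable
    (((hint hα zero_le_two).mul_prod (hint hβ le_rfl)).add
      ((hint hα le_rfl).mul_prod (hint hβ zero_le_two)))

lemma integral_norm_sq_mul_exp_dissipationSymbol (hα : 0 < α) (hβ : 0 < β) {τ : ℝ}
    (hτ : 0 < τ) :
    ∫ ξ : Plane, ‖ξ‖ ^ 2 * Real.exp (-(τ * dissipationSymbol α β ξ)) =
      (∫ x, semigroupWeight (2 * α) 2 τ x) * (∫ x, semigroupWeight (2 * β) 0 τ x) +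
        (∫ x, semigroupWeight (2 * α) 0 τ x) * ∫ x, semigroupWeight (2 * β) 2 τ x := by
  have hint {γ q : ℝ} (hγ : 0 < γ) (hq : 0 ≤ q) : Integrable (semigroupWeight (2 * γ) q τ) :=
    integrable_semigroupWeight (by positivity) (by linarith) hτ
  simp only [norm_sq_mul_exp_dissipationSymbol]
  rw [measurePreserving_coords.integral_comp measurableEmbedding_coords fun z : ℝ × ℝ =>
      semigroupWeight (2 * α) 2 τ z.1 * semigroupWeight (2 * β) 0 τ z.2 +
        semigroupWeight (2 * α) 0 τ z.1 * semigroupWeight (2 * β) 2 τ z.2,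
    Measure.volume_eq_prod, ← integral_prod_mul, ← integral_prod_mul]
  exact integral_add ((hint hα zero_le_two).mul_prod (hint hβ le_rfl))
    ((hint hα le_rfl).mul_prod (hint hβ zero_le_two))

lemma exists_integral_norm_sq_mul_exp_dissipationSymbol_le (hα : 0 < α) (hβ : 0 < β) :
    ∃ c : ℝ, 0 ≤ c ∧ ∀ τ : ℝ, 1 ≤ τ →
      ∫ ξ : Plane, ‖ξ‖ ^ 2 * Real.exp (-(τ * dissipationSymbol α β ξ)) ≤
        c * τ ^ (-(min (α + 3 * β) (3 * α + β) / (2 * α * β))) := by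
  obtain ⟨a₂, ha₂, hα₂⟩ := exists_integral_semigroupWeight_eq (p := 2 * α) (q := 2)
    (by positivity) (by norm_num)
  obtain ⟨a₀, ha₀, hα₀⟩ := exists_integral_semigroupWeight_eq (p := 2 * α) (q := 0)
    (by positivity) (by norm_num)
  obtain ⟨b₂, hb₂, hβ₂⟩ := exists_integral_semigroupWeight_eq (p := 2 * β) (q := 2)
    (by positivity) (by norm_num)
  obtain ⟨b₀, hb₀, hβ₀⟩ := exists_integral_semigroupWeight_eq (p := 2 * β) (q := 0)
    (by positivity) (by norm_num)
  refine ⟨a₂ * b₀ + a₀ * b₂, by positivity, fun τ hτ => ?_⟩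
  have hτ0 : 0 < τ := one_pos.trans_le hτ
  have hexp₁ : -((2 + 1) / (2 * α)) + -((0 + 1) / (2 * β)) = -((α + 3 * β) / (2 * α * β)) := by
    field_simp
    ring
  have hexp₂ : -((0 + 1) / (2 * α)) + -((2 + 1) / (2 * β)) = -((3 * α + β) / (2 * α * β)) := by
    field_simp
    ring
  rw [integral_norm_sq_mul_exp_dissipationSymbol hα hβ hτ0, hα₂ τ hτ0, hα₀ τ hτ0, hβ₂ τ hτ0,
    hβ₀ τ hτ0, mul_mul_mul_comm, mul_mul_mul_comm a₀, ← Real.rpow_add hτ0, ← Real.rpow_add hτ0,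
    hexp₁, hexp₂, add_mul]
  gcongr
  · exact min_le_left _ _
  · exact min_le_right _ _

end GradientDecay

/-! ### Uniqueness of weak solutions on the Fourier side -/

section LinearVolterra

variable {E : Type*} [NormedAddCommGroup E] [NormedSpace ℂ E] {M : E →L[ℂ] E}
  {d : ℝ → E →L[ℂ] ℂ} {B T : ℝ}

lemma norm_le_of_eq_neg_integral (hB : ∀ t ∈ Set.Icc 0 T, ‖d t‖ ≤ B)
    (hd : ∀ χ, ∀ t ∈ Set.Icc 0 T, d t χ = -∫ s in (0 : ℝ)..t, d s (M χ)) (n : ℕ) :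
    ∀ t ∈ Set.Icc 0 T, ‖d t‖ ≤ B * ((‖M‖ * t) ^ n / n.factorial) := by
  induction n with
  | zero => simpa using hB
  | succ n ih =>
    intro t ht
    have hB0 : 0 ≤ B := (norm_nonneg _).trans (hB t ht)
    have ht0 : 0 ≤ t := ht.1
    refine (d t).opNorm_le_bound (by positivity) fun χ => ?_
    calc ‖d t χ‖ = ‖∫ s in (0 : ℝ)..t, d s (M χ)‖ := by rw [hd χ t ht, norm_neg]
      _ ≤ ∫ s in (0 : ℝ)..t, B * ‖M‖ ^ (n + 1) * ‖χ‖ / n.factorial * s ^ n := by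
          refine intervalIntegral.norm_integral_le_of_norm_le ht0 (.of_forall fun s hs => ?_)
            (Continuous.intervalIntegrable (by fun_prop) _ _)
          calc ‖d s (M χ)‖ ≤ B * ((‖M‖ * s) ^ n / n.factorial) * (‖M‖ * ‖χ‖) :=
                (d s).le_of_opNorm_le_of_le (ih s ⟨hs.1.le, hs.2.trans ht.2⟩) (M.le_opNorm χ)
            _ = B * ‖M‖ ^ (n + 1) * ‖χ‖ / n.factorial * s ^ n := by ring
      _ = B * ((‖M‖ * t) ^ (n + 1) / (n + 1).factorial) * ‖χ‖ := by
          rw [intervalIntegral.integral_const_mul, integral_pow, Nat.factorial_succ]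
          push_cast
          field_simp
          ring

lemma eq_zero_of_eq_neg_integral (hB : ∀ t ∈ Set.Icc 0 T, ‖d t‖ ≤ B)
    (hd : ∀ χ, ∀ t ∈ Set.Icc 0 T, d t χ = -∫ s in (0 : ℝ)..t, d s (M χ)) {t : ℝ}
    (ht : t ∈ Set.Icc 0 T) : d t = 0 := by
  have hlim := (FloorSemiring.tendsto_pow_div_factorial_atTop (‖M‖ * t)).const_mul B
  rw [mul_zero] at hlim
  exact norm_le_zero_iff.mp
    (ge_of_tendsto' hlim fun n => norm_le_of_eq_neg_integral hB hd n t ht)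

lemma eq_zero_of_dense_eq_neg_integral {A : Type*} {ι : A → E} (hι : DenseRange ι)
    (hB : ∀ t ∈ Set.Icc 0 T, ‖d t‖ ≤ B)
    (hmeas : ∀ χ, ∀ t ∈ Set.Icc 0 T,
      AEStronglyMeasurable (fun s => d s χ) (volume.restrict (Set.Ioc 0 t)))
    (hd : ∀ φ, ∀ t ∈ Set.Icc 0 T, d t (ι φ) = -∫ s in (0 : ℝ)..t, d s (M (ι φ))) {t : ℝ}
    (ht : t ∈ Set.Icc 0 T) : d t = 0 := by
  refine eq_zero_of_eq_neg_integral (M := M) hB (fun χ t ht => congrFun (hι.equalizer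
    (h := fun χ => -∫ s in (0 : ℝ)..t, d s (M χ)) (d t).continuous
    (continuous_iff_continuousAt.mpr fun χ₀ => ?_).neg (funext fun φ => hd φ t ht)) χ) ht
  refine intervalIntegral.continuousAt_of_dominated_interval (bound := fun _ => B * (‖M χ₀‖ + 1))
    (.of_forall fun χ => by rw [Set.uIoc_of_le ht.1]; exact hmeas (M χ) t ht) ?_
    intervalIntegrable_const (.of_forall fun s _ => by fun_prop)
  filter_upwards [M.continuous.norm.continuousAt.eventually_lt continuousAt_const
    (lt_add_one ‖M χ₀‖)] with χ hχ
  refine .of_forall fun s hs => ?_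
  rw [Set.uIoc_of_le ht.1] at hs
  exact (d s).le_of_opNorm_le_of_le (hB s ⟨hs.1.le, hs.2.trans ht.2⟩) hχ.le

end LinearVolterra

section LocalDuhamel

variable {Ω : Type*} [MeasurableSpace Ω] {m w : Ω → ℝ} {N : ℝ → Ω → ℂ} {X₀ ψ : Ω → ℂ}

lemma IsForcing.norm_mul_duhamel_le (hN : IsForcing w N) (hm0 : ∀ ξ, 0 ≤ m ξ) {t T : ℝ}
    (ht : t ∈ Set.Icc 0 T) (ξ : Ω) :
    ‖ψ ξ * duhamel m N X₀ t ξ‖ ≤ ‖ψ ξ‖ * (‖X₀ ξ‖ + w ξ * T) := by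
  rw [norm_mul]
  gcongr
  refine (hN.norm_duhamel_le hm0 ht.1 ξ).trans ?_
  have := hN.weight_nonneg ξ
  gcongr
  exact ht.2

variable [TopologicalSpace Ω] [OpensMeasurableSpace Ω] {μ : Measure Ω} [IsFiniteMeasureOnCompacts μ]

lemma memLp_norm_mul_add_weight (hw : Continuous w) (hX₀ : MemLp X₀ 2 μ) (hψ : Continuous ψ)
    (hψc : HasCompactSupport ψ) (p q : ℝ≥0∞) [q.HolderTriple 2 p] (T : ℝ) :
    MemLp (fun ξ => ‖ψ ξ‖ * (‖X₀ ξ‖ + w ξ * T)) p μ := by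
  have hw' : Continuous fun ξ => ‖ψ ξ‖ * (w ξ * T) := by fun_prop
  simp only [mul_add]
  exact (hX₀.norm.mul (hψ.memLp_of_hasCompactSupport hψc (p := q)).norm).add
    (hw'.memLp_of_hasCompactSupport hψc.norm.mul_right)

lemma IsForcing.memLp_mul_duhamel (hN : IsForcing w N) (hm : Continuous m) (hm0 : ∀ ξ, 0 ≤ m ξ)
    (hw : Continuous w) (hX₀ : MemLp X₀ 2 μ) (hψ : Continuous ψ) (hψc : HasCompactSupport ψ)
    (p q : ℝ≥0∞) [q.HolderTriple 2 p] {t : ℝ} (ht : 0 ≤ t) :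
    MemLp (fun ξ => ψ ξ * duhamel m N X₀ t ξ) p μ :=
  (memLp_norm_mul_add_weight hw hX₀ hψ hψc p q t).of_le
    (hψ.aestronglyMeasurable.mul (hN.aestronglyMeasurable_duhamel_apply hm.measurable hX₀.1 t))
    (.of_forall fun ξ => (hN.norm_mul_duhamel_le hm0 ⟨ht, le_rfl⟩ ξ).trans (le_abs_self _))

variable [SecondCountableTopology Ω] [SFinite μ]

lemma IsForcing.integrable_prod_mul_duhamel (hN : IsForcing w N) (hm : Continuous m)
    (hm0 : ∀ ξ, 0 ≤ m ξ) (hw : Continuous w) (hX₀ : MemLp X₀ 2 μ) (hψ : Continuous ψ)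
    (hψc : HasCompactSupport ψ) (t : ℝ) :
    Integrable (fun p : ℝ × Ω => ψ p.2 * duhamel m N X₀ p.1 p.2)
      ((volume.restrict (Set.Ioc 0 t)).prod μ) := by
  have hmaj := memLp_one_iff_integrable.mp (memLp_norm_mul_add_weight hw hX₀ hψ hψc 1 2 t)
  refine (hmaj.comp_snd _).mono' ((hψ.comp continuous_snd).aestronglyMeasurable.mul
    (hN.aestronglyMeasurable_duhamel hm.measurable hX₀.1 _)) ?_
  filter_upwards [Measure.quasiMeasurePreserving_fst.ae (ae_restrict_mem measurableSet_Ioc)]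
    with p hp
  exact hN.norm_mul_duhamel_le hm0 (Set.Ioc_subset_Icc_self hp) p.2

lemma IsForcing.integrable_prod_mul (hN : IsForcing w N) (hw : Continuous w) (hψ : Continuous ψ)
    (hψc : HasCompactSupport ψ) (t : ℝ) :
    Integrable (fun p : ℝ × Ω => ψ p.2 * N p.1 p.2)
      ((volume.restrict (Set.Ioc 0 t)).prod μ) := by
  have hmaj : Integrable (fun ξ => ‖ψ ξ‖ * w ξ) μ :=
    (hψ.norm.mul hw).integrable_of_hasCompactSupport hψc.norm.mul_right
  refine (hmaj.comp_snd _).mono' ((hψ.comp continuous_snd).aestronglyMeasurable.mul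
    hN.stronglyMeasurable.aestronglyMeasurable) (.of_forall fun p => ?_)
  rw [norm_mul]
  gcongr
  exact hN.norm_le _ _

lemma IsForcing.integral_duhamel_mul_sub (hN : IsForcing w N) (hm : Continuous m)
    (hm0 : ∀ ξ, 0 ≤ m ξ) (hw : Continuous w) (hX₀ : MemLp X₀ 2 μ) (hψ : Continuous ψ)
    (hψc : HasCompactSupport ψ) {t : ℝ} (ht : 0 ≤ t) :
    (∫ ξ, duhamel m N X₀ t ξ * ψ ξ ∂μ) - ∫ ξ, X₀ ξ * ψ ξ ∂μ =
      ∫ s in (0 : ℝ)..t, ((∫ ξ, N s ξ * ψ ξ ∂μ) - ∫ ξ, duhamel m N X₀ s ξ * (m ξ * ψ ξ) ∂μ) := by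
  have hmψ : Continuous fun ξ => (m ξ : ℂ) * ψ ξ := by fun_prop
  have hNint := hN.integrable_prod_mul (μ := μ) hw hψ hψc t
  have hVint := hN.integrable_prod_mul_duhamel hm hm0 hw hX₀ hmψ hψc.mul_left t
  have hpt : ∀ ξ, ψ ξ * duhamel m N X₀ t ξ - ψ ξ * X₀ ξ =
      ∫ s in Set.Ioc 0 t, (ψ ξ * N s ξ - m ξ * ψ ξ * duhamel m N X₀ s ξ) := fun ξ => by
    rw [← mul_sub, ← duhamel_zero_time (m := m) (N := N) (X₀ := X₀) ξ,
      duhamel_sub (hN.intervalIntegrable ξ) 0 t,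
      ← intervalIntegral.integral_of_le ht, ← intervalIntegral.integral_const_mul]
    simp only [Complex.real_smul, mul_sub, mul_left_comm, mul_assoc]
  have hX₀int : Integrable (fun ξ => ψ ξ * X₀ ξ) μ :=
    (hψ.memLp_of_hasCompactSupport (p := 2) hψc).integrable_mul hX₀
  simp only [mul_comm (duhamel m N X₀ _ _), mul_comm (X₀ _), mul_comm (N _ _),
    intervalIntegral.integral_of_le ht]
  rw [← integral_sub (memLp_one_iff_integrable.mp
    (hN.memLp_mul_duhamel hm hm0 hw hX₀ hψ hψc 1 2 ht)) hX₀int,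
    integral_congr_ae (.of_forall hpt), ← integral_integral_swap
      (f := fun s ξ => ψ ξ * N s ξ - m ξ * ψ ξ * duhamel m N X₀ s ξ) (hNint.sub hVint)]
  refine integral_congr_ae ?_
  filter_upwards [hNint.prod_right_ae, hVint.prod_right_ae] with s hNs hVs
  exact integral_sub hNs hVs

lemma IsForcing.intervalIntegrable_integral_mul (hN : IsForcing w N) (hw : Continuous w)
    (hψ : Continuous ψ) (hψc : HasCompactSupport ψ) {t : ℝ} (ht : 0 ≤ t) :
    IntervalIntegrable (fun s => ∫ ξ, N s ξ * ψ ξ ∂μ) volume 0 t := by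
  rw [intervalIntegrable_iff_integrableOn_Ioc_of_le ht]
  simpa only [IntegrableOn, mul_comm (ψ _)] using
    (hN.integrable_prod_mul (μ := μ) hw hψ hψc t).integral_prod_left

lemma IsForcing.intervalIntegrable_integral_duhamel_mul (hN : IsForcing w N) (hm : Continuous m)
    (hm0 : ∀ ξ, 0 ≤ m ξ) (hw : Continuous w) (hX₀ : MemLp X₀ 2 μ) (hψ : Continuous ψ)
    (hψc : HasCompactSupport ψ) {t : ℝ} (ht : 0 ≤ t) :
    IntervalIntegrable (fun s => ∫ ξ, duhamel m N X₀ s ξ * ψ ξ ∂μ) volume 0 t := by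
  rw [intervalIntegrable_iff_integrableOn_Ioc_of_le ht]
  simpa only [IntegrableOn, mul_comm (ψ _)] using
    (hN.integrable_prod_mul_duhamel hm hm0 hw hX₀ hψ hψc t).integral_prod_left

end LocalDuhamel

lemma exists_clm_eq_mul_on {Ω : Type*} [TopologicalSpace Ω] [T2Space Ω] [MeasurableSpace Ω]
    [OpensMeasurableSpace Ω] {μ : Measure Ω} {g : Ω → ℂ} (hg : Continuous g) {K : Set Ω}
    (hK : IsCompact K) :
    ∃ M : Lp ℂ 2 μ →L[ℂ] Lp ℂ 2 μ, ∀ χ, ∀ᵐ ξ ∂μ, ξ ∈ K → M χ ξ = g ξ * χ ξ := by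
  obtain ⟨b, hb⟩ := hK.exists_bound_of_continuousOn hg.continuousOn
  have hgK : MemLp (K.indicator g) ∞ μ := by
    refine memLp_top_of_bound (hg.measurable.indicator hK.measurableSet).aestronglyMeasurable
      (max b 0) (.of_forall fun ξ => ?_)
    by_cases hξ : ξ ∈ K
    · simpa only [Set.indicator_of_mem hξ] using (hb ξ hξ).trans (le_max_left _ _)
    · simp [Set.indicator_of_notMem hξ]
  refine ⟨(ContinuousLinearMap.mul ℂ ℂ).holderL μ ∞ 2 2 (hgK.toLp _), fun χ => ?_⟩
  filter_upwards [(ContinuousLinearMap.mul ℂ ℂ).coeFn_holder (r := 2) (hgK.toLp _) χ,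
    hgK.coeFn_toLp] with ξ hM hgξ hξ
  rw [ContinuousLinearMap.holderL_apply_apply, hM, hgξ, Set.indicator_of_mem hξ]
  rfl

lemma exists_schwartz_hasCompactSupport_eq_one {E : Type*} [NormedAddCommGroup E]
    [NormedSpace ℝ E] [FiniteDimensional ℝ E] (R : ℝ) :
    ∃ ψ : 𝓢(E, ℂ), HasCompactSupport ψ ∧ ∀ ξ, ‖ξ‖ ≤ R → ψ ξ = 1 := by
  let η : ContDiffBump (0 : E) := ⟨|R| + 1, |R| + 2, by positivity, by linarith⟩
  have hη : HasCompactSupport fun ξ => (η ξ : ℂ) :=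
    η.hasCompactSupport.comp_left Complex.ofReal_zero
  have hη' : ContDiff ℝ ∞ fun ξ => (η ξ : ℂ) := Complex.ofRealCLM.contDiff.comp η.contDiff
  refine ⟨hη.toSchwartzMap hη', hη, fun ξ hξ => ?_⟩
  have hη1 : η ξ = 1 :=
    η.one_of_mem_closedBall (mem_closedBall_zero_iff.mpr
      (by linarith [le_abs_self R]))
  simp [hη1]

lemma inner_star_toLp {Ω : Type*} [MeasurableSpace Ω] {μ : Measure Ω} {g : Ω → ℂ}
    (hg : MemLp g 2 μ) (f : Lp ℂ 2 μ) :
    inner ℂ (hg.star.toLp _) f = ∫ ξ, f ξ * g ξ ∂μ := by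
  rw [L2.inner_def]
  refine integral_congr_ae ?_
  filter_upwards [hg.star.coeFn_toLp] with ξ hξ
  rw [hξ, RCLike.inner_apply, Pi.star_apply, starRingEnd_apply, star_star]

section Weak

variable {E : Type*} [NormedAddCommGroup E] [NormedSpace ℝ E] [MeasurableSpace E]

/-- Weak solutions of `∂ₜ X = N - m X`, `X(0) = X₀`, locally bounded in time with values in `L²`.
In the applications the space variable is a frequency. -/
structure IsFourierSolution (μ : Measure E) (m : E → ℝ) (N : ℝ → E → ℂ) (X₀ : Lp ℂ 2 μ)
    (X : ℝ → Lp ℂ 2 μ) : Prop where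
  measurable : AEStronglyMeasurable X (volume.restrict (Set.Ioi (0 : ℝ)))
  locally_bounded : ∀ T : ℝ, ∃ M : ℝ, ∀ t ∈ Set.Icc 0 T, ‖X t‖ ≤ M
  equation : ∀ (φ : 𝓢(E, ℂ)) (t : ℝ), 0 ≤ t →
    (∫ ξ, X t ξ * φ ξ ∂μ) - ∫ ξ, X₀ ξ * φ ξ ∂μ =
      ∫ s in (0 : ℝ)..t, ((∫ ξ, N s ξ * φ ξ ∂μ) - ∫ ξ, X s ξ * (m ξ * φ ξ) ∂μ)

variable {μ : Measure E} {m w : E → ℝ} {N : ℝ → E → ℂ} {X₀ : Lp ℂ 2 μ} {X : ℝ → Lp ℂ 2 μ}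

/-- The function `conj (ψ (X t - V t))`, `V` the Duhamel solution, regarded as an element of `L²`
for nonnegative `t`; the conjugate makes its inner products bilinear in `X` and the test
function. -/
def IsLocalDifference (m : E → ℝ) (N : ℝ → E → ℂ) (X₀ : Lp ℂ 2 μ) (X : ℝ → Lp ℂ 2 μ)
    (ψ : E → ℂ) (D : ℝ → Lp ℂ 2 μ) : Prop :=
  ∀ t, 0 ≤ t → D t =ᵐ[μ] fun ξ => star (ψ ξ * X t ξ - ψ ξ * duhamel m N X₀ t ξ)

section LocalDifference

variable {ψ : 𝓢(E, ℂ)} {D : ℝ → Lp ℂ 2 μ}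

lemma IsFourierSolution.aestronglyMeasurable_integral_mul (hX : IsFourierSolution μ m N X₀ X)
    {g : E → ℂ} (hg : MemLp g 2 μ) (t : ℝ) :
    AEStronglyMeasurable (fun s => ∫ ξ, X s ξ * g ξ ∂μ) (volume.restrict (Set.Ioc 0 t)) := by
  simp only [← inner_star_toLp hg]
  exact (innerSL ℂ (hg.star.toLp _)).continuous.comp_aestronglyMeasurable
    (hX.measurable.mono_set Set.Ioc_subset_Ioi_self)

lemma IsFourierSolution.intervalIntegrable_integral_mul (hX : IsFourierSolution μ m N X₀ X)
    {g : E → ℂ} (hg : MemLp g 2 μ) {t : ℝ} (ht : 0 ≤ t) :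
    IntervalIntegrable (fun s => ∫ ξ, X s ξ * g ξ ∂μ) volume 0 t := by
  obtain ⟨M, hM⟩ := hX.locally_bounded t
  rw [intervalIntegrable_iff_integrableOn_Ioc_of_le ht]
  refine Integrable.of_bound (hX.aestronglyMeasurable_integral_mul hg t)
    (‖hg.star.toLp _‖ * M) ?_
  filter_upwards [ae_restrict_mem measurableSet_Ioc] with s hs
  rw [← inner_star_toLp hg]
  refine (norm_inner_le_norm _ _).trans ?_
  gcongr
  exact hM s (Set.Ioc_subset_Icc_self hs)

variable [BorelSpace E]

lemma memLp_schwartz_mul (ψ : 𝓢(E, ℂ)) (χ : Lp ℂ 2 μ) : MemLp (fun ξ => ψ ξ * χ ξ) 2 μ := by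
  obtain ⟨b, hb⟩ := ψ.decay 0 0
  exact (Lp.memLp χ).mul (memLp_top_of_bound ψ.continuous.aestronglyMeasurable b
    (.of_forall fun ξ => by simpa using hb.2 ξ))

variable [IsFiniteMeasureOnCompacts μ]

lemma IsForcing.exists_isLocalDifference (hN : IsForcing w N) (hm : Continuous m)
    (hm0 : ∀ ξ, 0 ≤ m ξ) (hw : Continuous w) (hψc : HasCompactSupport ψ) :
    ∃ D, IsLocalDifference m N X₀ X ψ D := by
  have hex : ∀ t, ∃ f : Lp ℂ 2 μ, 0 ≤ t →
      f =ᵐ[μ] fun ξ => star (ψ ξ * X t ξ - ψ ξ * duhamel m N X₀ t ξ) := fun t => by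
    by_cases ht : 0 ≤ t
    · have hV := hN.memLp_mul_duhamel hm hm0 hw (Lp.memLp X₀) ψ.continuous hψc 2 ∞ ht
      have hXV := (memLp_schwartz_mul ψ (X t)).sub hV
      exact ⟨hXV.star.toLp _, fun _ => hXV.star.coeFn_toLp⟩
    · exact ⟨0, fun h => absurd h ht⟩
  choose D hD using hex
  exact ⟨D, hD⟩

lemma IsLocalDifference.inner_eq (hD : IsLocalDifference m N X₀ X ψ D) (hN : IsForcing w N)
    (hm : Continuous m) (hm0 : ∀ ξ, 0 ≤ m ξ) (hw : Continuous w) (hψc : HasCompactSupport ψ)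
    (χ : Lp ℂ 2 μ) {t : ℝ} (ht : 0 ≤ t) :
    inner ℂ (D t) χ =
      (∫ ξ, X t ξ * (ψ ξ * χ ξ) ∂μ) - ∫ ξ, duhamel m N X₀ t ξ * (ψ ξ * χ ξ) ∂μ := by
  have hX : Integrable (fun ξ => X t ξ * (ψ ξ * χ ξ)) μ :=
    (Lp.memLp (X t)).integrable_mul (memLp_schwartz_mul ψ χ)
  have hV : Integrable (fun ξ => duhamel m N X₀ t ξ * (ψ ξ * χ ξ)) μ := by
    simpa only [mul_left_comm, mul_assoc, Pi.mul_def] using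
      (hN.memLp_mul_duhamel hm hm0 hw (Lp.memLp X₀) ψ.continuous hψc 2 ∞ ht).integrable_mul
        (Lp.memLp χ)
  rw [L2.inner_def, ← integral_sub hX hV]
  refine integral_congr_ae ?_
  filter_upwards [hD t ht] with ξ hξ
  rw [hξ, RCLike.inner_apply', starRingEnd_apply, star_star]
  ring

lemma IsLocalDifference.exists_norm_le (hD : IsLocalDifference m N X₀ X ψ D)
    (hN : IsForcing w N) (hm0 : ∀ ξ, 0 ≤ m ξ) (hw : Continuous w) (hψc : HasCompactSupport ψ)
    (hX : ∀ T : ℝ, ∃ M : ℝ, ∀ t ∈ Set.Icc 0 T, ‖X t‖ ≤ M) (T : ℝ) :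
    ∃ B, ∀ t ∈ Set.Icc 0 T, ‖D t‖ ≤ B := by
  obtain ⟨b, -, hb⟩ := ψ.decay 0 0
  obtain ⟨M, hM⟩ := hX T
  have hG := memLp_norm_mul_add_weight hw (Lp.memLp X₀) ψ.continuous hψc 2 ∞ T
  refine ⟨‖b‖ * M + ‖hG.toLp _‖, fun t ht => ?_⟩
  have hXn := (Lp.memLp (X t)).norm
  have hle : ‖D t‖ ≤ ‖b • hXn.toLp _ + hG.toLp _‖ := by
    refine Lp.norm_le_norm_of_ae_le ?_
    filter_upwards [hD t ht.1, Lp.coeFn_add (b • hXn.toLp _) (hG.toLp _),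
      Lp.coeFn_smul b (hXn.toLp _), hXn.coeFn_toLp, hG.coeFn_toLp] with ξ hDξ hadd hsmul hXξ hGξ
    rw [hDξ, hadd, Pi.add_apply, hsmul, Pi.smul_apply, hXξ, hGξ, norm_star, smul_eq_mul]
    refine (norm_sub_le _ _).trans ((add_le_add ?_ (hN.norm_mul_duhamel_le hm0 ht ξ)).trans
      (le_abs_self _))
    rw [norm_mul]
    gcongr
    simpa using hb ξ
  refine hle.trans ((norm_add_le _ _).trans ?_)
  rw [norm_smul, Lp.norm_toLp, eLpNorm_norm, ← Lp.norm_def]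
  gcongr
  exact hM t ht

variable [FiniteDimensional ℝ E]

lemma IsForcing.aestronglyMeasurable_integral_duhamel_mul (hN : IsForcing w N)
    (hm : Continuous m) (f : Lp ℂ 2 μ) {g : E → ℂ} (hg : AEStronglyMeasurable g μ)
    (ν : Measure ℝ) :
    AEStronglyMeasurable (fun s => ∫ ξ, duhamel m N f s ξ * g ξ ∂μ) ν :=
  AEStronglyMeasurable.integral_prod_right' (f := fun p : ℝ × E => duhamel m N f p.1 p.2 * g p.2)
    ((hN.aestronglyMeasurable_duhamel hm.measurable (Lp.aestronglyMeasurable f) ν).mul hg.comp_snd)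

lemma IsLocalDifference.aestronglyMeasurable_inner (hD : IsLocalDifference m N X₀ X ψ D)
    (hX : IsFourierSolution μ m N X₀ X) (hN : IsForcing w N)
    (hm : Continuous m) (hm0 : ∀ ξ, 0 ≤ m ξ) (hw : Continuous w) (hψc : HasCompactSupport ψ)
    (χ : Lp ℂ 2 μ) (t : ℝ) :
    AEStronglyMeasurable (fun s => inner ℂ (D s) χ) (volume.restrict (Set.Ioc 0 t)) := by
  have hψχ := memLp_schwartz_mul ψ χ
  refine ((hX.aestronglyMeasurable_integral_mul hψχ t).sub
    (hN.aestronglyMeasurable_integral_duhamel_mul hm X₀ hψχ.1 _)).congr ?_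
  filter_upwards [ae_restrict_mem measurableSet_Ioc] with s hs
  exact (hD.inner_eq hN hm hm0 hw hψc χ hs.1.le).symm

lemma IsLocalDifference.inner_toLp_eq (hD : IsLocalDifference m N X₀ X ψ D)
    (hX : IsFourierSolution μ m N X₀ X) (hN : IsForcing w N)
    (hm : Continuous m) (hm0 : ∀ ξ, 0 ≤ m ξ) (hw : Continuous w) (hψc : HasCompactSupport ψ)
    {M : Lp ℂ 2 μ →L[ℂ] Lp ℂ 2 μ}
    (hM : ∀ χ, ∀ᵐ ξ ∂μ, ξ ∈ tsupport ψ → M χ ξ = m ξ * χ ξ) [μ.HasTemperateGrowth]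
    (φ : 𝓢(E, ℂ)) {t : ℝ} (ht : 0 ≤ t) :
    inner ℂ (D t) (φ.toLp 2 μ) = -∫ s in (0 : ℝ)..t, inner ℂ (D s) (M (φ.toLp 2 μ)) := by
  set Φ : 𝓢(E, ℂ) := smulLeftCLM ℂ ψ φ
  have hΦ : ∀ ξ, Φ ξ = ψ ξ * φ ξ := fun ξ => smulLeftCLM_apply_apply ψ.hasTemperateGrowth φ ξ
  have hΦc : HasCompactSupport Φ := by
    rw [funext hΦ]
    exact hψc.mul_right
  have hφΦ : ∀ᵐ ξ ∂μ, ψ ξ * φ.toLp 2 μ ξ = Φ ξ := by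
    filter_upwards [φ.coeFn_toLp 2 μ] with ξ hξ
    rw [hξ, hΦ]
  have hMΦ : ∀ᵐ ξ ∂μ, ψ ξ * M (φ.toLp 2 μ) ξ = m ξ * Φ ξ := by
    filter_upwards [hM (φ.toLp 2 μ), φ.coeFn_toLp 2 μ] with ξ hMξ hξ
    by_cases hsupp : ξ ∈ tsupport ψ
    · rw [hMξ hsupp, hξ, hΦ, mul_left_comm]
    · rw [hΦ, image_eq_zero_of_notMem_tsupport hsupp, zero_mul, zero_mul, mul_zero]
  have hDφ : inner ℂ (D t) (φ.toLp 2 μ) =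
      (∫ ξ, X t ξ * Φ ξ ∂μ) - ∫ ξ, duhamel m N X₀ t ξ * Φ ξ ∂μ := by
    rw [hD.inner_eq hN hm hm0 hw hψc _ ht]
    congr 1 <;> exact integral_congr_ae (hφΦ.mono fun ξ hξ => congrArg _ hξ)
  have hDM : ∀ s ∈ Set.uIcc 0 t, inner ℂ (D s) (M (φ.toLp 2 μ)) =
      (∫ ξ, X s ξ * (m ξ * Φ ξ) ∂μ) - ∫ ξ, duhamel m N X₀ s ξ * (m ξ * Φ ξ) ∂μ := fun s hs => by
    rw [hD.inner_eq hN hm hm0 hw hψc _ (Set.uIcc_of_le ht ▸ hs).1]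
    congr 1 <;> exact integral_congr_ae (hMΦ.mono fun ξ hξ => congrArg _ hξ)
  have hmΦ : Continuous fun ξ => (m ξ : ℂ) * Φ ξ :=
    (Complex.continuous_ofReal.comp hm).mul Φ.continuous
  have hXint := hX.intervalIntegrable_integral_mul
    (hmΦ.memLp_of_hasCompactSupport hΦc.mul_left) ht
  have hNint := hN.intervalIntegrable_integral_mul (μ := μ) hw Φ.continuous hΦc ht
  have hVint := hN.intervalIntegrable_integral_duhamel_mul hm hm0 hw (Lp.memLp X₀) hmΦ
    hΦc.mul_left ht
  have hXeq := hX.equation Φ t ht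
  have hVeq := hN.integral_duhamel_mul_sub hm hm0 hw (Lp.memLp X₀) Φ.continuous hΦc ht
  rw [intervalIntegral.integral_sub hNint hXint] at hXeq
  rw [intervalIntegral.integral_sub hNint hVint] at hVeq
  rw [hDφ, intervalIntegral.integral_congr hDM, intervalIntegral.integral_sub hXint hVint]
  linear_combination hXeq - hVeq

lemma IsFourierSolution.ae_eq_duhamel [μ.HasTemperateGrowth] (hX : IsFourierSolution μ m N X₀ X)
    (hN : IsForcing w N) (hm : Continuous m) (hm0 : ∀ ξ, 0 ≤ m ξ) (hw : Continuous w)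
    {t : ℝ} (ht : 0 ≤ t) :
    X t =ᵐ[μ] duhamel m N X₀ t := by
  have hball : ∀ n : ℕ, ∀ᵐ ξ ∂μ, ‖ξ‖ ≤ n → X t ξ = duhamel m N X₀ t ξ := fun n => by
    obtain ⟨ψ, hψc, hψ⟩ := exists_schwartz_hasCompactSupport_eq_one (E := E) n
    obtain ⟨D, hD⟩ := hN.exists_isLocalDifference (X₀ := X₀) (X := X) hm hm0 hw hψc
    obtain ⟨B, hB⟩ := hD.exists_norm_le hN hm0 hw hψc hX.locally_bounded t
    obtain ⟨M, hM⟩ := exists_clm_eq_mul_on (μ := μ) (Complex.continuous_ofReal.comp hm)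
      hψc.isCompact
    have hDt : innerSL ℂ (D t) = 0 := eq_zero_of_dense_eq_neg_integral (M := M)
      (d := fun s => innerSL ℂ (D s)) (denseRange_toLpCLM ENNReal.ofNat_ne_top)
      (fun s hs => (innerSL_apply_norm ℂ (D s)).trans_le (hB s hs))
      (fun χ s _ => hD.aestronglyMeasurable_inner hX hN hm hm0 hw hψc χ s)
      (fun φ s hs => hD.inner_toLp_eq hX hN hm hm0 hw hψc hM φ hs.1) ⟨ht, le_rfl⟩
    have hDt0 : D t = 0 := by rw [← norm_eq_zero, ← innerSL_apply_norm ℂ, hDt, norm_zero]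
    have hzero := hD t ht
    rw [hDt0] at hzero
    filter_upwards [hzero, Lp.coeFn_zero ℂ 2 μ] with ξ hξ hξ0 hξn
    rw [hξ0, Pi.zero_apply, eq_comm, star_eq_zero, hψ ξ hξn, one_mul, one_mul, sub_eq_zero] at hξ
    exact hξ
  filter_upwards [ae_all_iff.mpr hball] with ξ hξ
  obtain ⟨n, hn⟩ := exists_nat_ge ‖ξ‖
  exact hξ n hn

end LocalDifference

end Weak

/-! ### Energy of the difference from the linear flow -/

section Energy

/-- The squared `L²` norm of `f`. -/
def energy {Ω F : Type*} [MeasurableSpace Ω] [NormedAddCommGroup F] (μ : Measure Ω) (f : Ω → F) :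
    ℝ :=
  ∫ ξ, ‖f ξ‖ ^ 2 ∂μ

/-- The measure of integration over the times `(s, t]` and the space `Ω`. -/
abbrev slab {Ω : Type*} [MeasurableSpace Ω] (μ : Measure Ω) (s t : ℝ) : Measure (ℝ × Ω) :=
  (volume.restrict (Set.Ioc s t)).prod μ

/-- The energy inequality on `[s, t]`, up to the error `δ`, for a dissipation with symbol `m`. -/
structure HasEnergyInequality {Ω F : Type*} [MeasurableSpace Ω] [NormedAddCommGroup F]
    (μ : Measure Ω) (m : Ω → ℝ) (X : ℝ → Ω → F) (δ s t : ℝ) : Prop where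
  integrable_dissipation : Integrable (fun p : ℝ × Ω => m p.2 * ‖X p.1 p.2‖ ^ 2) (slab μ s t)
  energy_le : energy μ (X t) + 2 * ∫ p, m p.2 * ‖X p.1 p.2‖ ^ 2 ∂slab μ s t ≤ energy μ (X s) + δ

lemma energy_nonneg {Ω F : Type*} [MeasurableSpace Ω] [NormedAddCommGroup F] (μ : Measure Ω)
    (f : Ω → F) : 0 ≤ energy μ f :=
  integral_nonneg fun _ => sq_nonneg _

lemma energy_coeFn {Ω F : Type*} [MeasurableSpace Ω] [NormedAddCommGroup F]
    [InnerProductSpace ℝ F] {μ : Measure Ω} (f : Lp F 2 μ) : energy μ f = ‖f‖ ^ 2 := by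
  rw [← real_inner_self_eq_norm_sq, L2.inner_def]
  simp only [energy, real_inner_self_eq_norm_sq]

lemma energy_congr {Ω F : Type*} [MeasurableSpace Ω] [NormedAddCommGroup F] {μ : Measure Ω}
    {f g : Ω → F} (h : f =ᵐ[μ] g) : energy μ f = energy μ g :=
  integral_congr_ae (h.mono fun ξ hξ => by dsimp only; rw [hξ])

lemma energy_le_of_norm_le {Ω F : Type*} [MeasurableSpace Ω] [NormedAddCommGroup F] {μ : Measure Ω}
    {f g : Ω → F} (hg : MemLp g 2 μ) (h : ∀ ξ, ‖f ξ‖ ≤ ‖g ξ‖) : energy μ f ≤ energy μ g :=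
  integral_mono_of_nonneg (.of_forall fun _ => sq_nonneg _) hg.norm.integrable_sq <|
    .of_forall fun ξ => pow_le_pow_left₀ (norm_nonneg _) (h ξ) 2

lemma integral_mul_norm_le_sqrt_energy {Ω F : Type*} [MeasurableSpace Ω] [NormedAddCommGroup F]
    {μ : Measure Ω} {g : Ω → ℝ} {f : Ω → F} (hg : MemLp g 2 μ) (hf : MemLp f 2 μ) :
    ∫ ξ, g ξ * ‖f ξ‖ ∂μ ≤ √(energy μ g) * √(energy μ f) := by
  have hle : ∫ ξ, g ξ * ‖f ξ‖ ∂μ ≤ ∫ ξ, ‖g ξ‖ * ‖f ξ‖ ∂μ :=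
    integral_mono (hg.integrable_mul hf.norm) (hg.norm.integrable_mul hf.norm) fun ξ =>
      mul_le_mul_of_nonneg_right (le_abs_self _) (norm_nonneg _)
  refine hle.trans ?_
  simpa [energy, Real.sqrt_eq_rpow] using integral_mul_norm_le_Lp_mul_Lq (p := 2) (q := 2)
    (g := fun ξ => ‖f ξ‖) Real.HolderConjugate.two_two (by simpa using hg) (by simpa using hf.norm)

variable {Ω F : Type*} [NormedAddCommGroup F] [InnerProductSpace ℝ F]
  {m w : Ω → ℝ} {N : ℝ → Ω → F} {X₀ : Ω → F}

/-- The difference `|V|² - |W|²`, where `V` is the Duhamel solution with initial value `X₀` and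
`W = V - e^{-tm} X₀`. -/
def energyGap (m : Ω → ℝ) (N : ℝ → Ω → F) (X₀ : Ω → F) (t : ℝ) (ξ : Ω) : ℝ :=
  ‖duhamel m N X₀ t ξ‖ ^ 2 - ‖duhamel m N 0 t ξ‖ ^ 2

/-- The density of the work of the forcing on the linear flow. -/
def workDensity (m : Ω → ℝ) (N : ℝ → Ω → F) (X₀ : Ω → F) (t : ℝ) (ξ : Ω) : ℝ :=
  inner ℝ (linearFlow m X₀ t ξ) (N t ξ)

lemma energyGap_eq_inner_linearFlow (t : ℝ) (ξ : Ω) :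
    energyGap m N X₀ t ξ =
      inner ℝ (linearFlow m X₀ t ξ) (linearFlow m X₀ t ξ + (2 : ℝ) • duhamel m N 0 t ξ) := by
  rw [energyGap, duhamel_eq_add (X₀ := X₀), norm_add_sq_real, inner_add_right, inner_smul_right,
    real_inner_self_eq_norm_sq]
  ring

-- The gap is linear in `N`: it is the pairing of `X₀` with a Duhamel solution for the symbol `2 m`.
lemma energyGap_eq_inner_duhamel (t : ℝ) (ξ : Ω) :
    energyGap m N X₀ t ξ = inner ℝ (X₀ ξ) (duhamel (fun ξ => 2 * m ξ)
      (fun σ ξ => (2 : ℝ) • linearFlow m (N σ) σ ξ) X₀ t ξ) := by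
  have hexp (σ : ℝ) : Real.exp (2 * m ξ * σ) • (2 : ℝ) • linearFlow m (N σ) σ ξ =
      (2 : ℝ) • Real.exp (m ξ * σ) • N σ ξ := by
    rw [linearFlow, smul_comm, smul_smul (Real.exp _), ← Real.exp_add]
    ring_nf
  have hsq : Real.exp (-(2 * m ξ * t)) = Real.exp (-(m ξ * t)) * Real.exp (-(m ξ * t)) := by
    rw [← Real.exp_add]
    ring_nf
  rw [energyGap_eq_inner_linearFlow]
  simp only [duhamel, hexp, hsq, intervalIntegral.integral_smul, Pi.zero_apply, zero_add]
  simp only [linearFlow, inner_add_right, real_inner_smul_left, inner_smul_right]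
  ring

lemma energyGap_sub [CompleteSpace F] {ξ : Ω}
    (hN : ∀ x y : ℝ, IntervalIntegrable (fun σ => N σ ξ) volume x y) (s t : ℝ) :
    energyGap m N X₀ t ξ - energyGap m N X₀ s ξ =
      ∫ σ in s..t, (2 * workDensity m N X₀ σ ξ - 2 * (m ξ * energyGap m N X₀ σ ξ)) := by
  have hN' (x y : ℝ) :
      IntervalIntegrable (fun σ => (2 : ℝ) • linearFlow m (N σ) σ ξ) volume x y := by
    simpa only [linearFlow, neg_mul, Pi.smul_def] using
      (intervalIntegrable_exp_smul hN (-m ξ) x y).smul (2 : ℝ)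
  have hint : IntervalIntegrable (fun σ => (2 : ℝ) • linearFlow m (N σ) σ ξ - (2 * m ξ) •
      duhamel (fun ξ => 2 * m ξ) (fun σ ξ => (2 : ℝ) • linearFlow m (N σ) σ ξ) X₀ σ ξ) volume s t :=
    (hN' s t).sub (((continuous_duhamel hN').const_smul _).intervalIntegrable s t)
  rw [energyGap_eq_inner_duhamel, energyGap_eq_inner_duhamel, ← inner_sub_right,
    duhamel_sub hN', ← innerSL_apply_apply ℝ, ← (innerSL ℝ (X₀ ξ)).intervalIntegral_comp_comm hint]
  congr! with σ
  rw [innerSL_apply_apply, inner_sub_right, inner_smul_right, inner_smul_right,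
    ← energyGap_eq_inner_duhamel, workDensity, linearFlow, linearFlow, real_inner_smul_left,
    inner_smul_right, mul_assoc 2 (m ξ)]

variable [MeasurableSpace Ω]

lemma IsForcing.abs_workDensity_le (hN : IsForcing w N) (hm0 : ∀ ξ, 0 ≤ m ξ) {s t : ℝ}
    (hst : s ≤ t) (ξ : Ω) : |workDensity m N X₀ t ξ| ≤ linearFlow m w s ξ * ‖X₀ ξ‖ :=
  calc |workDensity m N X₀ t ξ| ≤ ‖linearFlow m X₀ t ξ‖ * ‖N t ξ‖ := abs_real_inner_le_norm _ _
    _ ≤ ‖linearFlow m X₀ s ξ‖ * w ξ := by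
      gcongr
      exacts [norm_linearFlow_le hm0 hst ξ, hN.norm_le t ξ]
    _ = linearFlow m w s ξ * ‖X₀ ξ‖ := by
      rw [linearFlow, linearFlow, norm_smul, Real.norm_of_nonneg (Real.exp_pos _).le, smul_eq_mul]
      ring

lemma IsForcing.abs_energyGap_le (hN : IsForcing w N) (hm0 : ∀ ξ, 0 ≤ m ξ) {t : ℝ} (ht : 0 ≤ t)
    (ξ : Ω) :
    |energyGap m N X₀ t ξ| ≤ Real.exp (-(m ξ * t)) * ‖X₀ ξ‖ * (‖X₀ ξ‖ + 2 * (w ξ * t)) := by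
  rw [energyGap_eq_inner_linearFlow]
  refine (abs_real_inner_le_norm _ _).trans ?_
  have hL : ‖linearFlow m X₀ t ξ‖ = Real.exp (-(m ξ * t)) * ‖X₀ ξ‖ := by
    rw [linearFlow, norm_smul, Real.norm_of_nonneg (Real.exp_pos _).le]
  have hW : ‖duhamel m N 0 t ξ‖ ≤ w ξ * t := by simpa using hN.norm_duhamel_le (X₀ := 0) hm0 ht ξ
  nth_rw 1 [hL]
  gcongr
  refine norm_add_le_of_le ((norm_linearFlow_le hm0 ht ξ).trans_eq ?_) ?_
  · rw [linearFlow_zero_time]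
  · rw [norm_smul, Real.norm_ofNat]
    gcongr

lemma mul_exp_neg_mul_le {a : ℝ} (ha : 0 < a) (x : ℝ) : x * Real.exp (-(x * a)) ≤ 1 / a := by
  rw [Real.exp_neg, ← div_eq_mul_inv, div_le_div_iff₀ (Real.exp_pos _) ha]
  linarith [Real.add_one_le_exp (x * a)]

lemma IsForcing.abs_mul_energyGap_le (hN : IsForcing w N) (hm0 : ∀ ξ, 0 ≤ m ξ) {s t σ : ℝ}
    (hs : 0 < s) (hσ : σ ∈ Set.Ioc s t) (ξ : Ω) :
    |m ξ * energyGap m N X₀ σ ξ| ≤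
      2 / s * (‖X₀ ξ‖ ^ 2 + 2 * t * (linearFlow m w (s / 2) ξ * ‖X₀ ξ‖)) := by
  have hm := hm0 ξ
  have hw := hN.weight_nonneg ξ
  have hσ0 : 0 < σ := hs.trans hσ.1
  have ht : 0 < t := hσ0.trans_le hσ.2
  set e := Real.exp (-(m ξ * (s / 2))) with he
  have hme : m ξ * e ≤ 2 / s := by simpa using mul_exp_neg_mul_le (half_pos hs) (m ξ)
  have he1 : e ≤ 1 := Real.exp_le_one_iff.mpr (neg_nonpos.mpr (by positivity))
  have hexp : Real.exp (-(m ξ * σ)) ≤ e * e := by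
    rw [he, ← Real.exp_add]
    gcongr
    nlinarith [hσ.1]
  rw [abs_mul, abs_of_nonneg hm]
  calc m ξ * |energyGap m N X₀ σ ξ|
      ≤ m ξ * (e * e * ‖X₀ ξ‖ * (‖X₀ ξ‖ + 2 * (w ξ * t))) := by
        gcongr
        refine (hN.abs_energyGap_le hm0 hσ0.le ξ).trans ?_
        gcongr
        exact hσ.2
    _ = m ξ * e * (e * ‖X₀ ξ‖ ^ 2 + 2 * t * (e * w ξ * ‖X₀ ξ‖)) := by ring
    _ ≤ 2 / s * (1 * ‖X₀ ξ‖ ^ 2 + 2 * t * (e * w ξ * ‖X₀ ξ‖)) := by gcongr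
    _ = 2 / s * (‖X₀ ξ‖ ^ 2 + 2 * t * (linearFlow m w (s / 2) ξ * ‖X₀ ξ‖)) := by
        rw [one_mul, linearFlow, smul_eq_mul]

variable {μ : Measure Ω}

lemma ae_fst_mem_slab (s t : ℝ) : ∀ᵐ p ∂slab μ s t, p.1 ∈ Set.Ioc s t :=
  Measure.quasiMeasurePreserving_fst.ae (ae_restrict_mem measurableSet_Ioc)

lemma memLp_linearFlow (hm : Measurable m) (hm0 : ∀ ξ, 0 ≤ m ξ) (hX₀ : MemLp X₀ 2 μ) {t : ℝ}
    (ht : 0 ≤ t) : MemLp (linearFlow m X₀ t) 2 μ :=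
  hX₀.of_le (aestronglyMeasurable_linearFlow_apply hm hX₀.1 t) <| .of_forall fun ξ =>
    (norm_linearFlow_le hm0 ht ξ).trans_eq (by rw [linearFlow_zero_time])

lemma memLp_duhamel_zero (hm : Measurable m) (hm0 : ∀ ξ, 0 ≤ m ξ) (hX₀ : MemLp X₀ 2 μ) {t : ℝ}
    (ht : 0 ≤ t) (hV : MemLp (duhamel m N X₀ t) 2 μ) : MemLp (duhamel m N 0 t) 2 μ := by
  refine (hV.sub (memLp_linearFlow hm hm0 hX₀ ht)).ae_eq (.of_forall fun ξ => ?_)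
  rw [Pi.sub_apply, duhamel_eq_add, add_sub_cancel_left]

section Comparison

variable [SFinite μ] (hN : IsForcing w N) (hm : Measurable m) (hm0 : ∀ ξ, 0 ≤ m ξ)
  (hX₀ : MemLp X₀ 2 μ)
include hN hm hm0 hX₀

lemma IsForcing.integrable_workDensity {s : ℝ} (hws : MemLp (linearFlow m w s) 2 μ) (t : ℝ) :
    Integrable (fun p : ℝ × Ω => workDensity m N X₀ p.1 p.2) (slab μ s t) := by
  refine ((hws.integrable_mul hX₀.norm).comp_snd _).mono'
    ((aestronglyMeasurable_linearFlow hm hX₀.1 _).inner (𝕜 := ℝ)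
      hN.stronglyMeasurable.aestronglyMeasurable) ?_
  filter_upwards [ae_fst_mem_slab s t] with p hp
  exact hN.abs_workDensity_le hm0 hp.1.le p.2

lemma IsForcing.abs_integral_workDensity_le {s t : ℝ} (hst : s ≤ t)
    (hws : MemLp (linearFlow m w s) 2 μ) :
    |∫ p, workDensity m N X₀ p.1 p.2 ∂slab μ s t| ≤
      (t - s) * (√(energy μ (linearFlow m w s)) * √(energy μ X₀)) :=
  calc |∫ p, workDensity m N X₀ p.1 p.2 ∂slab μ s t|
      ≤ ∫ p, |workDensity m N X₀ p.1 p.2| ∂slab μ s t := abs_integral_le_integral_abs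
    _ ≤ ∫ p, linearFlow m w s p.2 * ‖X₀ p.2‖ ∂slab μ s t := by
      refine integral_mono_ae (hN.integrable_workDensity hm hm0 hX₀ hws t).norm
        ((hws.integrable_mul hX₀.norm).comp_snd _) ?_
      filter_upwards [ae_fst_mem_slab s t] with p hp
      exact hN.abs_workDensity_le hm0 hp.1.le p.2
    _ = (t - s) * ∫ ξ, linearFlow m w s ξ * ‖X₀ ξ‖ ∂μ := by
      rw [integral_fun_snd (fun ξ => linearFlow m w s ξ * ‖X₀ ξ‖)]
      simp [hst]
    _ ≤ (t - s) * (√(energy μ (linearFlow m w s)) * √(energy μ X₀)) := by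
      have := sub_nonneg.mpr hst
      gcongr
      exact integral_mul_norm_le_sqrt_energy hws hX₀

lemma IsForcing.integrable_mul_energyGap {s : ℝ} (hs : 0 < s)
    (hws : MemLp (linearFlow m w (s / 2)) 2 μ) (t : ℝ) :
    Integrable (fun p : ℝ × Ω => m p.2 * energyGap m N X₀ p.1 p.2) (slab μ s t) := by
  have hdom : Integrable (fun ξ =>
      2 / s * (‖X₀ ξ‖ ^ 2 + 2 * t * (linearFlow m w (s / 2) ξ * ‖X₀ ξ‖))) μ :=
    (hX₀.norm.integrable_sq.add ((hws.integrable_mul hX₀.norm).const_mul _)).const_mul _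
  have hgap : AEStronglyMeasurable (Function.uncurry (energyGap m N X₀)) (slab μ s t) :=
    ((hN.aestronglyMeasurable_duhamel hm hX₀.1 _).norm.pow 2).sub
      ((hN.stronglyMeasurable_duhamel_zero hm).aestronglyMeasurable.norm.pow 2)
  refine (hdom.comp_snd _).mono' ((hm.comp measurable_snd).aestronglyMeasurable.mul hgap) ?_
  filter_upwards [ae_fst_mem_slab s t] with p hp
  exact hN.abs_mul_energyGap_le hm0 hs hp p.2

variable (hw : ∀ s > 0, MemLp (linearFlow m w s) 2 μ)
include hw

lemma IsForcing.integral_energyGap_sub [CompleteSpace F] {s t : ℝ} (hs : 0 < s) (hst : s ≤ t)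
    (hgs : Integrable (energyGap m N X₀ s) μ) (hgt : Integrable (energyGap m N X₀ t) μ) :
    ∫ ξ, energyGap m N X₀ t ξ ∂μ - ∫ ξ, energyGap m N X₀ s ξ ∂μ =
      2 * (∫ p, workDensity m N X₀ p.1 p.2 ∂slab μ s t) -
        2 * ∫ p, m p.2 * energyGap m N X₀ p.1 p.2 ∂slab μ s t := by
  have hwork := (hN.integrable_workDensity hm hm0 hX₀ (hw s hs) t).const_mul 2
  have hgap := (hN.integrable_mul_energyGap hm hm0 hX₀ hs (hw _ (half_pos hs)) t).const_mul 2
  have hsub : Integrable (fun p : ℝ × Ω => 2 * workDensity m N X₀ p.1 p.2 -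
      2 * (m p.2 * energyGap m N X₀ p.1 p.2)) (slab μ s t) := hwork.sub hgap
  rw [← integral_sub hgt hgs, ← integral_const_mul, ← integral_const_mul,
    ← integral_sub hwork hgap, integral_prod_symm _ hsub]
  congr! with ξ
  rw [energyGap_sub (hN.intervalIntegrable ξ), intervalIntegral.integral_of_le hst]

theorem IsForcing.hasEnergyInequality_duhamel_zero [CompleteSpace F] {s t : ℝ} (hs : 0 < s)
    (hst : s ≤ t) (hVs : MemLp (duhamel m N X₀ s) 2 μ) (hVt : MemLp (duhamel m N X₀ t) 2 μ)
    (hV : HasEnergyInequality μ m (duhamel m N X₀) 0 s t) :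
    HasEnergyInequality μ m (duhamel m N 0)
      (2 * (t - s) * (√(energy μ (linearFlow m w s)) * √(energy μ X₀))) s t := by
  have hWs := memLp_duhamel_zero hm hm0 hX₀ hs.le hVs
  have hWt := memLp_duhamel_zero hm hm0 hX₀ (hs.le.trans hst) hVt
  have hgap := hN.integrable_mul_energyGap hm hm0 hX₀ hs (hw _ (half_pos hs)) t
  have hsplit (p : ℝ × Ω) : m p.2 * ‖duhamel m N 0 p.1 p.2‖ ^ 2 =
      m p.2 * ‖duhamel m N X₀ p.1 p.2‖ ^ 2 - m p.2 * energyGap m N X₀ p.1 p.2 := by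
    rw [energyGap]
    ring
  have hevol := hN.integral_energyGap_sub hm hm0 hX₀ hw hs hst
    (hVs.norm.integrable_sq.sub hWs.norm.integrable_sq)
    (hVt.norm.integrable_sq.sub hWt.norm.integrable_sq)
  simp only [energyGap] at hevol
  rw [integral_sub hVt.norm.integrable_sq hWt.norm.integrable_sq,
    integral_sub hVs.norm.integrable_sq hWs.norm.integrable_sq] at hevol
  refine ⟨(hV.integrable_dissipation.sub hgap).congr (.of_forall fun p => (hsplit p).symm), ?_⟩
  simp only [hsplit]
  rw [integral_sub hV.integrable_dissipation hgap]
  have hVle := hV.energy_le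
  have hwork := neg_le_of_abs_le (hN.abs_integral_workDensity_le hm hm0 hX₀ hst (hw s hs))
  simp only [energy, energyGap] at hVle hwork ⊢
  linarith

end Comparison
end Energy

/-! ### Fourier splitting and decay -/

section FourierSplitting

variable {Ω F : Type*} [MeasurableSpace Ω] {μ : Measure Ω} [NormedAddCommGroup F]
  [InnerProductSpace ℝ F] {m w : Ω → ℝ} {N : ℝ → Ω → F} {X₀ : Ω → F}

/-- A forcing term whose Duhamel solution with initial value `X₀` has the energy bounds of a Leray
solution. -/
structure IsLerayForcing (μ : Measure Ω) (m w : Ω → ℝ) (X₀ : Ω → F) (N : ℝ → Ω → F) : Prop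
    extends IsForcing w N where
  memLp : ∀ t ≥ 0, MemLp (duhamel m N X₀ t) 2 μ
  energy_le : ∀ t ≥ 0, energy μ (duhamel m N X₀ t) ≤ energy μ X₀
  energy_ae : ∀ᵐ s ∂volume.restrict (Set.Ioi (0 : ℝ)), ∀ t ≥ s,
    HasEnergyInequality μ m (duhamel m N X₀) 0 s t

lemma IsLerayForcing.memLp_initial (hN : IsLerayForcing μ m w X₀ N) : MemLp X₀ 2 μ :=
  (hN.memLp 0 le_rfl).ae_eq (.of_forall duhamel_zero_time)

lemma IsLerayForcing.memLp_duhamel_zero (hN : IsLerayForcing μ m w X₀ N) (hm : Measurable m)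
    (hm0 : ∀ ξ, 0 ≤ m ξ) {t : ℝ} (ht : 0 ≤ t) : MemLp (duhamel m N 0 t) 2 μ :=
  AnisoSQG.memLp_duhamel_zero hm hm0 hN.memLp_initial ht (hN.memLp t ht)

lemma energy_sub_le {f g : Ω → F} (hf : MemLp f 2 μ) (hg : MemLp g 2 μ) :
    energy μ (f - g) ≤ 2 * (energy μ f + energy μ g) := by
  have hf2 := hf.norm.integrable_sq
  have hg2 := hg.norm.integrable_sq
  rw [energy, energy, energy, ← integral_add hf2 hg2, ← integral_const_mul]
  refine integral_mono (hf.sub hg).norm.integrable_sq ((hf2.add hg2).const_mul 2) fun ξ => ?_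
  have := parallelogram_law_with_norm ℝ (f ξ) (g ξ)
  dsimp only [Pi.sub_apply, Pi.add_apply]
  nlinarith [sq_nonneg ‖f ξ + g ξ‖]

lemma IsLerayForcing.energy_duhamel_zero_le (hN : IsLerayForcing μ m w X₀ N) (hm : Measurable m)
    (hm0 : ∀ ξ, 0 ≤ m ξ) {t : ℝ} (ht : 0 ≤ t) :
    energy μ (duhamel m N 0 t) ≤ 4 * energy μ X₀ := by
  have hL := memLp_linearFlow hm hm0 hN.memLp_initial ht
  have hsub : duhamel m N 0 t = duhamel m N X₀ t - linearFlow m X₀ t := by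
    ext ξ
    rw [Pi.sub_apply, duhamel_eq_add (X₀ := X₀), add_sub_cancel_left]
  have hLle : energy μ (linearFlow m X₀ t) ≤ energy μ X₀ :=
    energy_le_of_norm_le hN.memLp_initial fun ξ =>
      (norm_linearFlow_le hm0 ht ξ).trans_eq (by rw [linearFlow_zero_time])
  rw [hsub]
  linarith [energy_sub_le (hN.memLp t ht) hL, hN.energy_le t ht]

-- Where `m < 1 / r`, the bound `|W| ≤ w τ` is comparable to `e^{-rm} w τ`.
lemma IsForcing.sub_div_le_dissipation (hN : IsForcing w N) (hm0 : ∀ ξ, 0 ≤ m ξ) {τ r : ℝ}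
    (hτ : 0 ≤ τ) (hr : 0 < r) (ξ : Ω) :
    (‖duhamel m N 0 τ ξ‖ ^ 2 - Real.exp 2 * τ ^ 2 * ‖linearFlow m w r ξ‖ ^ 2) / r ≤
      m ξ * ‖duhamel m N 0 τ ξ‖ ^ 2 := by
  have hw := hN.weight_nonneg ξ
  rcases le_or_gt 1 (m ξ * r) with hhigh | hlow
  · rw [div_le_iff₀ hr]
    have : 0 ≤ Real.exp 2 * τ ^ 2 * ‖linearFlow m w r ξ‖ ^ 2 := by positivity
    nlinarith [sq_nonneg ‖duhamel m N 0 τ ξ‖]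
  · have hW : ‖duhamel m N 0 τ ξ‖ ≤ Real.exp 1 * τ * ‖linearFlow m w r ξ‖ :=
      calc ‖duhamel m N 0 τ ξ‖ ≤ w ξ * τ := by simpa using hN.norm_duhamel_le (X₀ := 0) hm0 hτ ξ
        _ ≤ Real.exp (1 + -(m ξ * r)) * (w ξ * τ) :=
          le_mul_of_one_le_left (by positivity) (Real.one_le_exp (by linarith))
        _ = Real.exp 1 * τ * ‖linearFlow m w r ξ‖ := by
          rw [linearFlow, norm_smul, Real.norm_of_nonneg (Real.exp_pos _).le,
            Real.norm_of_nonneg hw, Real.exp_add]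
          ring
    have hsq : ‖duhamel m N 0 τ ξ‖ ^ 2 ≤ Real.exp 2 * τ ^ 2 * ‖linearFlow m w r ξ‖ ^ 2 :=
      (pow_le_pow_left₀ (norm_nonneg _) hW 2).trans_eq (by
        rw [mul_pow, mul_pow, ← Real.exp_nat_mul]
        norm_num)
    have := hm0 ξ
    exact (div_nonpos_of_nonpos_of_nonneg (by linarith) hr.le).trans (by positivity)

lemma IsForcing.energy_sub_div_le (hN : IsForcing w N) (hm0 : ∀ ξ, 0 ≤ m ξ) {τ r : ℝ} (hτ : 0 ≤ τ)
    (hr : 0 < r) (hW : MemLp (duhamel m N 0 τ) 2 μ) (hw : MemLp (linearFlow m w r) 2 μ)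
    (hdiss : Integrable (fun ξ => m ξ * ‖duhamel m N 0 τ ξ‖ ^ 2) μ) :
    (energy μ (duhamel m N 0 τ) - Real.exp 2 * τ ^ 2 * energy μ (linearFlow m w r)) / r ≤
      ∫ ξ, m ξ * ‖duhamel m N 0 τ ξ‖ ^ 2 ∂μ := by
  have hlow := hw.norm.integrable_sq.const_mul (Real.exp 2 * τ ^ 2)
  rw [energy, energy, ← integral_const_mul, ← integral_sub hW.norm.integrable_sq hlow,
    ← integral_div]
  exact integral_mono ((hW.norm.integrable_sq.sub hlow).div_const r) hdiss
    (hN.sub_div_le_dissipation hm0 hτ hr)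

lemma IsLerayForcing.hasEnergyInequality_duhamel_zero [SFinite μ] [CompleteSpace F]
    (hN : IsLerayForcing μ m w X₀ N) (hm : Measurable m) (hm0 : ∀ ξ, 0 ≤ m ξ)
    (hw : ∀ s > 0, MemLp (linearFlow m w s) 2 μ) :
    ∀ᵐ s ∂volume.restrict (Set.Ioi (0 : ℝ)), ∀ t ≥ s,
      HasEnergyInequality μ m (duhamel m N 0)
        (2 * (t - s) * (√(energy μ (linearFlow m w s)) * √(energy μ X₀))) s t := by
  filter_upwards [hN.energy_ae, ae_restrict_mem measurableSet_Ioi] with s hs hs0 t hst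
  exact hN.toIsForcing.hasEnergyInequality_duhamel_zero hm hm0 hN.memLp_initial hw hs0 hst
    (hN.memLp s (le_of_lt hs0)) (hN.memLp t ((le_of_lt hs0).trans hst)) (hs t hst)

theorem IsLerayForcing.fourier_splitting [SFinite μ] [CompleteSpace F]
    (hN : IsLerayForcing μ m w X₀ N) (hm : Measurable m) (hm0 : ∀ ξ, 0 ≤ m ξ)
    (hw : ∀ s > 0, MemLp (linearFlow m w s) 2 μ) :
    ∀ᵐ s ∂volume.restrict (Set.Ioi (0 : ℝ)), ∀ t ≥ s, ∀ r > 0,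
      (1 + 2 * (t - s) / r) * energy μ (duhamel m N 0 t) ≤ energy μ (duhamel m N 0 s) +
        (1 + 2 * (t - s) / r) * (2 * (t - s) * (√(energy μ (linearFlow m w s)) * √(energy μ X₀))) +
        2 * (t - s) / r * (Real.exp 2 * t ^ 2 * energy μ (linearFlow m w r)) := by
  have hcmp := hN.hasEnergyInequality_duhamel_zero hm hm0 hw
  filter_upwards [hcmp, ae_restrict_mem measurableSet_Ioi] with s hs hs0 t hst r hr
  set δ := 2 * (t - s) * (√(energy μ (linearFlow m w s)) * √(energy μ X₀)) with hδ
  have hWt : ∀ᵐ τ ∂volume.restrict (Set.Ioc s t),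
      energy μ (duhamel m N 0 t) - δ ≤ energy μ (duhamel m N 0 τ) := by
    filter_upwards [ae_restrict_of_ae_restrict_of_subset (fun τ hτ => hs0.trans hτ.1) hcmp,
      ae_restrict_mem measurableSet_Ioc] with τ hτ hmem
    have hanti : energy μ (linearFlow m w τ) ≤ energy μ (linearFlow m w s) :=
      energy_le_of_norm_le (hw s hs0) (norm_linearFlow_le hm0 hmem.1.le)
    have hδτ : 2 * (t - τ) * (√(energy μ (linearFlow m w τ)) * √(energy μ X₀)) ≤ δ := by
      have : 0 ≤ t - s := sub_nonneg.mpr hst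
      have := hmem.1
      rw [hδ]
      gcongr
    have hdiss : 0 ≤ ∫ p, m p.2 * ‖duhamel m N 0 p.1 p.2‖ ^ 2 ∂slab μ τ t :=
      integral_nonneg fun p => mul_nonneg (hm0 _) (sq_nonneg _)
    linarith [(hτ t hmem.2).energy_le]
  have hdiss : (t - s) * ((energy μ (duhamel m N 0 t) - δ -
      Real.exp 2 * t ^ 2 * energy μ (linearFlow m w r)) / r) ≤
        ∫ p, m p.2 * ‖duhamel m N 0 p.1 p.2‖ ^ 2 ∂slab μ s t := by
    have hint := (hs t hst).integrable_dissipation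
    calc _ = ∫ _ in Set.Ioc s t, (energy μ (duhamel m N 0 t) - δ -
            Real.exp 2 * t ^ 2 * energy μ (linearFlow m w r)) / r := by simp [hst]
      _ ≤ ∫ τ in Set.Ioc s t, ∫ ξ, m ξ * ‖duhamel m N 0 τ ξ‖ ^ 2 ∂μ := by
        refine integral_mono_ae (integrable_const _) hint.integral_prod_left ?_
        filter_upwards [hWt, hint.prod_right_ae, ae_restrict_mem measurableSet_Ioc]
          with τ hτ hτint hmem
        have hτ0 : 0 ≤ τ := le_of_lt (hs0.trans hmem.1)
        refine le_trans ?_ (hN.energy_sub_div_le hm0 hτ0 hr (hN.memLp_duhamel_zero hm hm0 hτ0)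
          (hw r hr) hτint)
        have := energy_nonneg μ (linearFlow m w r)
        gcongr
        exact hmem.2
      _ = _ := (integral_prod _ hint).symm
  linear_combination (hs t hst).energy_le + 2 * hdiss

end FourierSplitting

section Decay

lemma exists_mem_Icc_of_ae {P : ℝ → Prop} (h : ∀ᵐ s ∂volume.restrict (Set.Ioi (0 : ℝ)), P s)
    {a b : ℝ} (ha : 0 < a) (hab : a < b) : ∃ s ∈ Set.Icc a b, P s := by
  have hsub : Set.Icc a b ⊆ Set.Ioi 0 := fun s hs => ha.trans_le hs.1
  have : (ae (volume.restrict (Set.Icc a b))).NeBot := by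
    rw [ae_neBot, Ne, Measure.restrict_eq_zero]
    simp [hab]
  exact ((ae_restrict_mem measurableSet_Icc).and
    (ae_restrict_of_ae_restrict_of_subset hsub h)).exists

lemma rpow_neg_le_of_div_le {s t k γ : ℝ} (hk : 0 < k) (ht : 0 < t) (hs : t / k ≤ s)
    (hγ : 0 ≤ γ) : s ^ (-γ) ≤ k ^ γ * t ^ (-γ) :=
  calc s ^ (-γ) ≤ (t / k) ^ (-γ) := Real.rpow_le_rpow_of_nonpos (by positivity) hs (by linarith)
    _ = k ^ γ * t ^ (-γ) := by
      rw [Real.div_rpow ht.le hk.le, Real.rpow_neg hk.le, div_inv_eq_mul, mul_comm]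

lemma le_mul_rpow_of_dyadic_recursion {y : ℝ → ℝ} {B T D K γ : ℝ} (hγ : 0 ≤ γ) (hT : 0 < T)
    (hD : 0 ≤ D) (hK : 4 ^ γ ≤ K) (hB : ∀ t ≥ 0, y t ≤ B) (hB0 : 0 ≤ B)
    (hrec : ∀ t > T, ∃ s ∈ Set.Icc (t / 4) (t / 2),
      (1 + K) * y t ≤ y s + D * (1 + t) ^ (-γ)) {t : ℝ} (ht : 0 ≤ t) :
    y t ≤ max (B * (1 + T) ^ γ) D * (1 + t) ^ (-γ) := by
  set M := max (B * (1 + T) ^ γ) D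
  have hinit : ∀ t ≥ 0, t ≤ T → y t ≤ M * (1 + t) ^ (-γ) := fun t ht htT =>
    calc y t ≤ B * 1 := by simpa using hB t ht
      _ ≤ B * ((1 + T) ^ γ * (1 + t) ^ (-γ)) := by
        rw [Real.rpow_neg (by positivity), ← div_eq_mul_inv]
        gcongr
        rw [one_le_div (by positivity)]
        gcongr
      _ ≤ M * (1 + t) ^ (-γ) := by
        rw [← mul_assoc]
        gcongr
        exact le_max_left _ _
  have hdyadic : ∀ n : ℕ, ∀ t ≥ 0, t ≤ T * 2 ^ n → y t ≤ M * (1 + t) ^ (-γ) := by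
    intro n
    induction n with
    | zero => simpa using hinit
    | succ n ih =>
      intro t ht htn
      rcases le_or_gt t T with htT | htT
      · exact hinit t ht htT
      obtain ⟨s, ⟨hs, hst⟩, h⟩ := hrec t htT
      have hM : 0 ≤ M := hD.trans (le_max_right _ _)
      have hys : y s ≤ M * (K * (1 + t) ^ (-γ)) := by
        refine (ih s (by linarith) (by rw [pow_succ] at htn; linarith)).trans ?_
        refine mul_le_mul_of_nonneg_left ?_ hM
        exact (rpow_neg_le_of_div_le four_pos (by positivity : 0 < 1 + t) (by linarith) hγ).trans <|
          by gcongr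
      have hDM : D * (1 + t) ^ (-γ) ≤ M * (1 + t) ^ (-γ) := by
        gcongr
        exact le_max_right _ _
      have hK0 : 0 < 1 + K := add_pos one_pos ((by positivity : (0 : ℝ) < 4 ^ γ).trans_le hK)
      exact le_of_mul_le_mul_left (by linarith) hK0
  obtain ⟨n, hn⟩ := pow_unbounded_of_one_lt (t / T) one_lt_two
  exact hdyadic n t ht ((div_le_iff₀' hT).mp hn.le)

variable {Ω F : Type*} [MeasurableSpace Ω] {μ : Measure Ω} [NormedAddCommGroup F]
  {m w : Ω → ℝ} {X₀ : Ω → F} {c γ : ℝ}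

lemma work_bound_le (hγ : 0 ≤ γ) (hc : 0 ≤ c)
    (hdecay : ∀ τ ≥ 1, energy μ (linearFlow m w τ) ≤ c * τ ^ (-(2 * γ + 2))) {s t : ℝ}
    (ht : 4 ≤ t) (hs : t / 4 ≤ s) :
    2 * (t - s) * (√(energy μ (linearFlow m w s)) * √(energy μ X₀)) ≤
      2 * √c * 8 ^ (γ + 1) * √(energy μ X₀) * (1 + t) ^ (-γ) := by
  have hs1 : 1 ≤ s := by linarith
  have hsqrt : √(energy μ (linearFlow m w s)) ≤ √c * (8 ^ (γ + 1) * (1 + t) ^ (-(γ + 1))) :=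
    calc √(energy μ (linearFlow m w s)) ≤ √(c * s ^ (-(2 * γ + 2))) :=
          Real.sqrt_le_sqrt (hdecay s hs1)
      _ = √c * s ^ (-(γ + 1)) := by
        rw [Real.sqrt_mul hc, Real.sqrt_eq_rpow (s ^ _), ← Real.rpow_mul (by linarith)]
        ring_nf
      _ ≤ √c * (8 ^ (γ + 1) * (1 + t) ^ (-(γ + 1))) := by
        gcongr
        exact rpow_neg_le_of_div_le (by norm_num) (by linarith) (by linarith) (by linarith)
  have ht0 : 0 < 1 + t := by linarith
  calc _ ≤ 2 * (1 + t) * (√c * (8 ^ (γ + 1) * (1 + t) ^ (-(γ + 1))) * √(energy μ X₀)) := by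
        gcongr
        linarith
    _ = 2 * √c * 8 ^ (γ + 1) * √(energy μ X₀) * ((1 + t) * (1 + t) ^ (-(γ + 1))) := by ring
    _ = _ := by
      rw [show -γ = 1 + -(γ + 1) by ring, Real.rpow_add ht0, Real.rpow_one]

lemma low_frequency_bound_le (hγ : 0 ≤ γ) (hc : 0 ≤ c)
    (hdecay : ∀ τ ≥ 1, energy μ (linearFlow m w τ) ≤ c * τ ^ (-(2 * γ + 2))) {t K : ℝ}
    (hK : 1 ≤ K) (ht : K ≤ t) :
    Real.exp 2 * t ^ 2 * energy μ (linearFlow m w (t / K)) ≤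
      Real.exp 2 * c * (2 * K) ^ (2 * γ + 2) * (1 + t) ^ (-γ) := by
  have hK0 : 0 < K := by linarith
  have ht0 : 0 < 1 + t := by linarith
  have hr : (1 + t) / (2 * K) ≤ t / K := by
    rw [div_le_div_iff₀ (by positivity) hK0]
    nlinarith
  have hlow : energy μ (linearFlow m w (t / K)) ≤
      c * ((2 * K) ^ (2 * γ + 2) * (1 + t) ^ (-(2 * γ + 2))) := by
    refine (hdecay _ ((one_le_div hK0).mpr ht)).trans ?_
    gcongr
    exact rpow_neg_le_of_div_le (by positivity) ht0 hr (by linarith)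
  calc _ ≤ Real.exp 2 * (1 + t) ^ 2 *
          (c * ((2 * K) ^ (2 * γ + 2) * (1 + t) ^ (-(2 * γ + 2)))) := by
        have := energy_nonneg μ (linearFlow m w (t / K))
        gcongr
        · linarith
        · linarith
    _ = Real.exp 2 * c * (2 * K) ^ (2 * γ + 2) * (1 + t) ^ (-(2 * γ)) := by
      rw [show -(2 * γ) = 2 + -(2 * γ + 2) by ring, Real.rpow_add ht0, Real.rpow_two]
      ring
    _ ≤ _ := by
      gcongr
      · linarith
      · linarith

theorem exists_energy_duhamel_zero_le [InnerProductSpace ℝ F] [CompleteSpace F] [SFinite μ]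
    (hm : Measurable m) (hm0 : ∀ ξ, 0 ≤ m ξ) (hw : ∀ s > 0, MemLp (linearFlow m w s) 2 μ)
    (hγ : 0 ≤ γ) (hc : 0 ≤ c)
    (hdecay : ∀ τ ≥ 1, energy μ (linearFlow m w τ) ≤ c * τ ^ (-(2 * γ + 2))) :
    ∃ M, ∀ N, IsLerayForcing μ m w X₀ N → ∀ t ≥ 0,
      energy μ (duhamel m N 0 t) ≤ M * (1 + t) ^ (-γ) := by
  set K : ℝ := 4 ^ γ
  have hK : 1 ≤ K := Real.one_le_rpow (by norm_num) hγ
  set A := 2 * √c * 8 ^ (γ + 1) * √(energy μ X₀)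
  set A' := Real.exp 2 * c * (2 * K) ^ (2 * γ + 2)
  refine ⟨max (4 * energy μ X₀ * (1 + 4 * K) ^ γ) ((1 + 2 * K) * A + 2 * K * A'),
    fun N hN t ht => le_mul_rpow_of_dyadic_recursion hγ (by positivity) (by positivity) le_rfl
      (fun t ht => hN.energy_duhamel_zero_le hm hm0 ht)
      (mul_nonneg four_pos.le (energy_nonneg _ _)) (fun t ht => ?_) ht⟩
  have ht0 : 0 < t := (by positivity : 0 < 4 * K).trans ht
  obtain ⟨s, ⟨hs, hst⟩, h⟩ := exists_mem_Icc_of_ae (hN.fourier_splitting hm hm0 hw)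
    (a := t / 4) (b := t / 2) (by positivity) (by linarith)
  refine ⟨s, ⟨hs, hst⟩, ?_⟩
  -- With `r = t / K` the coefficient `1 + 2 (t - s) / r` of the splitting is at least `1 + 4 ^ γ`,
  -- which beats the loss `4 ^ γ` of one dyadic step.
  have hkey := h t (by linarith) (t / K) (by positivity)
  have hwork := work_bound_le (X₀ := X₀) hγ hc hdecay (by linarith) hs
  have hlow := low_frequency_bound_le hγ hc hdecay hK (by linarith : K ≤ t)
  have hle : K ≤ 2 * (t - s) / (t / K) := by
    rw [le_div_iff₀ (by positivity), mul_div_cancel₀ _ (by positivity)]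
    linarith
  have hge : 2 * (t - s) / (t / K) ≤ 2 * K := by
    rw [div_le_iff₀ (by positivity), mul_assoc, mul_div_cancel₀ _ (by positivity)]
    linarith
  have hW := energy_nonneg μ (duhamel m N 0 t)
  calc _ ≤ (1 + 2 * (t - s) / (t / K)) * energy μ (duhamel m N 0 t) := by gcongr
    _ ≤ _ := hkey
    _ ≤ energy μ (duhamel m N 0 s) + (1 + 2 * K) * (A * (1 + t) ^ (-γ)) +
        2 * K * (A' * (1 + t) ^ (-γ)) := by
      have := energy_nonneg μ (linearFlow m w (t / K))
      have : 0 ≤ t - s := by linarith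
      gcongr
    _ = _ := by ring

end Decay

/-! ### The equation on the Fourier side -/

section FourierSide

lemma norm_eq_norm_of_ae {Ω E F : Type*} [MeasurableSpace Ω] [NormedAddCommGroup E]
    [NormedAddCommGroup F] {μ : Measure Ω} {p : ℝ≥0∞} {f : Lp E p μ} {g : Lp F p μ}
    (h : ∀ᵐ x ∂μ, ‖f x‖ = ‖g x‖) : ‖f‖ = ‖g‖ :=
  le_antisymm (Lp.norm_le_norm_of_ae_le (h.mono fun _ => le_of_eq))
    (Lp.norm_le_norm_of_ae_le (h.mono fun _ => ge_of_eq))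

lemma continuous_toComplex : Continuous toComplex :=
  (Complex.ofRealCLM.compLpL 2 volume).continuous

lemma coeFn_toComplex (f : RealL2) : toComplex f =ᵐ[volume] fun x => (f x : ℂ) :=
  Complex.ofRealCLM.coeFn_compLp f

lemma norm_toComplex (f : RealL2) : ‖toComplex f‖ = ‖f‖ :=
  norm_eq_norm_of_ae ((coeFn_toComplex f).mono fun x hx => by rw [hx, Complex.norm_real])

/-- The complex conjugate of the Fourier transform of a real-valued function. The conjugate makes
the pairing of `f` with a test function bilinear on the Fourier side. -/
def conjFourier : RealL2 →L[ℝ] ComplexL2 :=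
  (Complex.conjCLE.toContinuousLinearMap.compLpL 2 volume).comp <|
    ((fourierCLM ℂ ComplexL2).restrictScalars ℝ).comp (Complex.ofRealCLM.compLpL 2 volume)

lemma coeFn_conjFourier (f : RealL2) :
    conjFourier f =ᵐ[volume] fun ξ => star (𝓕 (toComplex f) ξ) :=
  Complex.conjCLE.toContinuousLinearMap.coeFn_compLp (𝓕 (toComplex f))

lemma norm_conjFourier (f : RealL2) : ‖conjFourier f‖ = ‖f‖ := by
  rw [← norm_toComplex f, ← Lp.norm_fourier_eq (toComplex f)]
  exact norm_eq_norm_of_ae ((coeFn_conjFourier f).mono fun ξ hξ => by rw [hξ, norm_star])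

lemma integral_ofReal_mul_eq (f : RealL2) (g : ComplexL2) :
    ∫ x, (f x : ℂ) * g x = ∫ ξ, conjFourier f ξ * 𝓕 g ξ :=
  calc ∫ x, (f x : ℂ) * g x = inner ℂ (toComplex f) g :=
        integral_congr_ae ((coeFn_toComplex f).mono fun x hx => by
          simp only [hx, RCLike.inner_apply, Complex.conj_ofReal, mul_comm])
    _ = inner ℂ (𝓕 (toComplex f)) (𝓕 g) := (Lp.inner_fourier_eq _ _).symm
    _ = ∫ ξ, conjFourier f ξ * 𝓕 g ξ :=
        integral_congr_ae ((coeFn_conjFourier f).mono fun ξ hξ => by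
          simp only [hξ, RCLike.inner_apply, mul_comm, Complex.star_def])

lemma fourier_toLp_fourierInv (χ : 𝓢(Plane, ℂ)) :
    𝓕 ((𝓕⁻ χ).toLp 2 : ComplexL2) = χ.toLp 2 := by
  rw [toLp_fourier_eq, fourier_fourierInv_eq]

lemma integral_ofReal_mul_fourierInv (f : RealL2) (χ : 𝓢(Plane, ℂ)) :
    ∫ x, (f x : ℂ) * 𝓕⁻ χ x = ∫ ξ, conjFourier f ξ * χ ξ :=
  calc ∫ x, (f x : ℂ) * 𝓕⁻ χ x = ∫ x, (f x : ℂ) * (𝓕⁻ χ).toLp 2 volume x :=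
        integral_congr_ae (((𝓕⁻ χ).coeFn_toLp 2 volume).mono fun x hx => by dsimp only; rw [hx])
    _ = ∫ ξ, conjFourier f ξ * χ.toLp 2 volume ξ := by
        rw [integral_ofReal_mul_eq, fourier_toLp_fourierInv]
    _ = ∫ ξ, conjFourier f ξ * χ ξ :=
        integral_congr_ae ((χ.coeFn_toLp 2 volume).mono fun ξ hξ => by dsimp only; rw [hξ])

lemma fourier_absDeriv_fourierInv (j : Fin 2) {s : ℝ} (hs : 0 ≤ s) (χ : 𝓢(Plane, ℂ)) :
    (𝓕 (absDeriv j s ((𝓕⁻ χ).toLp 2)) : ComplexL2) =ᵐ[volume]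
      fun ξ => absDerivSymbol j s ξ * χ ξ := by
  have h := memLp_absDeriv_schwartz j hs (𝓕⁻ χ)
  rw [absDeriv, fourierMultiplier, dif_pos h, fourier_fourierInv_eq]
  filter_upwards [h.coeFn_toLp, χ.coeFn_toLp 2 volume] with ξ hξ hχ
  rw [hξ, fourier_toLp_fourierInv, hχ]

lemma dissipationPairing_fourierInv {α β : ℝ} (hα : 0 ≤ α) (hβ : 0 ≤ β) (f : RealL2)
    (χ : 𝓢(Plane, ℂ)) :
    dissipationPairing α β f (𝓕⁻ χ) = ∫ ξ, conjFourier f ξ * (dissipationSymbol α β ξ * χ ξ) := by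
  set g₁ := absDeriv 0 (2 * α) ((𝓕⁻ χ).toLp 2)
  set g₂ := absDeriv 1 (2 * β) ((𝓕⁻ χ).toLp 2)
  calc dissipationPairing α β f (𝓕⁻ χ) = ∫ x, (f x : ℂ) * (g₁ + g₂ : ComplexL2) x :=
        integral_congr_ae ((Lp.coeFn_add g₁ g₂).mono fun x hx => by simp only [hx]; rfl)
    _ = ∫ ξ, conjFourier f ξ * 𝓕 (g₁ + g₂) ξ := integral_ofReal_mul_eq f _
    _ = _ := by
        rw [FourierTransform.fourier_add]
        refine integral_congr_ae ?_
        filter_upwards [Lp.coeFn_add (𝓕 g₁) (𝓕 g₂),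
          fourier_absDeriv_fourierInv 0 (mul_nonneg two_pos.le hα) χ,
          fourier_absDeriv_fourierInv 1 (mul_nonneg two_pos.le hβ) χ] with ξ hadd h₁ h₂
        rw [hadd, Pi.add_apply, h₁, h₂, dissipationSymbol, Complex.ofReal_add, add_mul]

end FourierSide

section Transport

lemma riesz_eq (j : Fin 2) (f : ComplexL2) : riesz j f = 𝓕⁻ ((memLp_riesz j f).toLp _) := by
  rw [riesz, fourierMultiplier, dif_pos (memLp_riesz j f)]

lemma riesz_sub (j : Fin 2) (f g : ComplexL2) : riesz j (f - g) = riesz j f - riesz j g := by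
  have hsub : (𝓕 (f - g) : ComplexL2) = 𝓕 f - 𝓕 g := (Lp.fourierTransformₗᵢ Plane ℂ).map_sub f g
  have hsub' (f g : ComplexL2) : (𝓕⁻ f - 𝓕⁻ g : ComplexL2) = 𝓕⁻ (f - g) :=
    ((Lp.fourierTransformₗᵢ Plane ℂ).symm.map_sub f g).symm
  rw [riesz_eq, riesz_eq, riesz_eq, hsub', ← MemLp.toLp_sub]
  congr 1
  refine MemLp.toLp_congr _ _ ?_
  filter_upwards [Lp.coeFn_sub (𝓕 f) (𝓕 g)] with ξ hξ
  rw [hsub, hξ, Pi.sub_apply, Pi.sub_apply, mul_sub]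

lemma norm_rieszSymbol_le (j : Fin 2) (ξ : Plane) : ‖rieszSymbol j ξ‖ ≤ 1 := by
  simpa [rieszSymbol] using div_le_one_of_le₀ (PiLp.norm_apply_le ξ j) (norm_nonneg ξ)

lemma norm_riesz_le (j : Fin 2) (f : ComplexL2) : ‖riesz j f‖ ≤ ‖f‖ := by
  rw [riesz_eq, ← Lp.norm_fourier_eq, fourier_fourierInv_eq, ← Lp.norm_fourier_eq f]
  refine Lp.norm_le_norm_of_ae_le ((memLp_riesz j f).coeFn_toLp.mono fun ξ hξ => ?_)
  rw [hξ, norm_mul]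
  exact mul_le_of_le_one_left (norm_nonneg _) (norm_rieszSymbol_le j ξ)

lemma continuous_riesz (j : Fin 2) : Continuous (riesz j) :=
  (LipschitzWith.of_dist_le_mul (K := 1) fun f g => by
    simpa [dist_eq_norm, riesz_sub] using norm_riesz_le j (f - g)).continuous

lemma continuous_velocity (j : Fin 2) : Continuous fun f : RealL2 => velocity f j := by
  fin_cases j
  · exact ((continuous_riesz 1).comp continuous_toComplex).neg
  · exact (continuous_riesz 0).comp continuous_toComplex

lemma norm_velocity_le (j : Fin 2) (f : RealL2) : ‖velocity f j‖ ≤ ‖f‖ := by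
  rw [← norm_toComplex f]
  fin_cases j
  · exact (norm_neg _).trans_le (norm_riesz_le 1 _)
  · exact norm_riesz_le 0 _

/-- The `j`-th component of the flux `f u`, `u = R^⊥ f`. -/
def flux (j : Fin 2) (f : RealL2) : Lp ℂ 1 (volume : Measure Plane) :=
  (ContinuousLinearMap.mul ℂ ℂ).holder 1 (toComplex f) (velocity f j)

lemma coeFn_flux (j : Fin 2) (f : RealL2) :
    flux j f =ᵐ[volume] fun x => (f x : ℂ) * velocity f j x := by
  filter_upwards [(ContinuousLinearMap.mul ℂ ℂ).coeFn_holder (r := 1) (toComplex f) (velocity f j),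
    coeFn_toComplex f] with x hflux hf
  rw [flux, hflux, hf, ContinuousLinearMap.mul_apply']

lemma norm_flux_le (j : Fin 2) (f : RealL2) : ‖flux j f‖ ≤ ‖f‖ ^ 2 :=
  calc ‖flux j f‖ ≤ ‖ContinuousLinearMap.mul ℂ ℂ‖ * ‖toComplex f‖ * ‖velocity f j‖ :=
        (ContinuousLinearMap.mul ℂ ℂ).norm_holder_apply_apply_le _ _
    _ ≤ 1 * ‖f‖ * ‖f‖ := by
        gcongr
        · exact ContinuousLinearMap.opNorm_mul_le ℂ ℂ
        · exact (norm_toComplex f).le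
        · exact norm_velocity_le j f
    _ = ‖f‖ ^ 2 := by ring

lemma continuous_flux (j : Fin 2) : Continuous (flux j) :=
  ((ContinuousLinearMap.mul ℂ ℂ).holderL volume 2 2 1).continuous₂.comp
    (continuous_toComplex.prodMk (continuous_velocity j))

/-- The function `ξ ↦ ∑ⱼ 2πi ξⱼ 𝓕⁻(f uⱼ)(ξ)`, with `u = R^⊥ f`, that represents the transport term
on the Fourier side. -/
def transportSymbol (f : RealL2) (ξ : Plane) : ℂ :=
  ∑ j : Fin 2, (2 * Real.pi * Complex.I * ξ j) * Real.Lp.fourierTransformInv (flux j f) ξ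

lemma continuous_uncurry_transportSymbol : Continuous (Function.uncurry transportSymbol) := by
  simp only [Function.uncurry_def, transportSymbol]
  refine continuous_finsetSum _ fun j _ => Continuous.mul (by fun_prop) ?_
  have hflux : Continuous fun f => Real.Lp.fourierTransformInv (flux j f) := by
    simpa [Function.comp_def] using
      (Real.Lp.fourierTransformInvCLM Plane ℂ).continuous.comp (continuous_flux j)
  exact continuous_eval.comp (hflux.prodMap continuous_id)

lemma norm_fourierTransformInv_le {V E : Type*} [NormedAddCommGroup V] [InnerProductSpace ℝ V]
    [FiniteDimensional ℝ V] [MeasurableSpace V] [BorelSpace V] [NormedAddCommGroup E]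
    [NormedSpace ℂ E] (f : Lp E 1 (volume : Measure V)) (ξ : V) :
    ‖Real.Lp.fourierTransformInv f ξ‖ ≤ ‖f‖ := by
  rw [Real.Lp.fourierTransformInv_apply, Real.fourierInv_eq, L1.norm_eq_integral_norm]
  refine (norm_integral_le_integral_norm _).trans_eq ?_
  simp_rw [Circle.norm_smul]

lemma norm_transportSymbol_le (f : RealL2) (ξ : Plane) :
    ‖transportSymbol f ξ‖ ≤ 4 * Real.pi * ‖f‖ ^ 2 * ‖ξ‖ := by
  have hterm : ∀ j : Fin 2, ‖(2 * Real.pi * Complex.I * ξ j) *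
      Real.Lp.fourierTransformInv (flux j f) ξ‖ ≤ 2 * Real.pi * ‖f‖ ^ 2 * ‖ξ‖ := fun j =>
    calc _ = 2 * Real.pi * ‖ξ j‖ * ‖Real.Lp.fourierTransformInv (flux j f) ξ‖ := by
          simp [abs_of_pos Real.pi_pos]
      _ ≤ 2 * Real.pi * ‖ξ‖ * ‖f‖ ^ 2 := by
          gcongr
          · exact PiLp.norm_apply_le ξ j
          · exact (norm_fourierTransformInv_le _ ξ).trans (norm_flux_le j f)
      _ = _ := by ring
  refine (norm_sum_le _ _).trans ((Finset.sum_le_sum fun j _ => hterm j).trans_eq ?_)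
  rw [Fin.sum_const, nsmul_eq_mul]
  ring

lemma integral_mul_fourierInv_eq {V : Type*} [NormedAddCommGroup V] [InnerProductSpace ℝ V]
    [FiniteDimensional ℝ V] [MeasurableSpace V] [BorelSpace V] (g : Lp ℂ 1 (volume : Measure V))
    (ψ : 𝓢(V, ℂ)) : ∫ x, g x * 𝓕⁻ ψ x = ∫ ξ, Real.Lp.fourierTransformInv g ξ * ψ ξ := by
  have hc : Continuous fun p : V × V => (-innerₗ V) p.1 p.2 := by
    simp only [LinearMap.neg_apply, innerₗ_apply_apply]
    fun_prop
  have hflip : (-innerₗ V).flip = -innerₗ V := by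
    ext x y
    simp [real_inner_comm]
  have h := VectorFourier.integral_fourierIntegral_smul_eq_flip (μ := volume) (ν := volume)
    Real.continuous_fourierChar hc (L1.integrable_coeFn g) ψ.integrable
  simp only [hflip, smul_eq_mul] at h
  simp only [Real.Lp.fourierTransformInv_apply, fourierInv_coe]
  exact h.symm

lemma exists_fourierInv_eq_fderiv (j : Fin 2) (χ : 𝓢(Plane, ℂ)) : ∃ ψ : 𝓢(Plane, ℂ),
    (∀ ξ, ψ ξ = 2 * Real.pi * Complex.I * ξ j * χ ξ) ∧
      ∀ x, fderiv ℝ (𝓕⁻ χ : 𝓢(Plane, ℂ)) x (EuclideanSpace.single j 1) =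
        (𝓕⁻ ψ : 𝓢(Plane, ℂ)) x := by
  refine ⟨(2 * Real.pi * Complex.I) •
    smulLeftCLM ℂ (inner ℝ · (EuclideanSpace.single j (1 : ℝ) : Plane)) χ, fun ξ => ?_, fun x => ?_⟩
  · have : (inner ℝ · (EuclideanSpace.single j (1 : ℝ) : Plane)).HasTemperateGrowth :=
      ((innerSL ℝ).flip _).hasTemperateGrowth
    simp only [smul_apply, smulLeftCLM_apply_apply this, smul_eq_mul]
    simp [EuclideanSpace.inner_single_right, mul_assoc]
  · rw [← lineDerivOp_apply_eq_fderiv, lineDerivOp_fourierInv_eq]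

lemma transportPairing_fourierInv (f : RealL2) (χ : 𝓢(Plane, ℂ)) :
    transportPairing f (𝓕⁻ χ) = ∫ ξ, transportSymbol f ξ * χ ξ := by
  choose ψ hψ hderiv using fun j => exists_fourierInv_eq_fderiv j χ
  have hint : ∀ j, Integrable fun x => flux j f x * 𝓕⁻ (ψ j) x := fun j =>
    (L1.integrable_coeFn _).mul_bdd (c := ‖(𝓕⁻ (ψ j)).toBoundedContinuousFunction‖)
      (𝓕⁻ (ψ j)).continuous.aestronglyMeasurable
      (.of_forall (𝓕⁻ (ψ j)).toBoundedContinuousFunction.norm_coe_le_norm)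
  have hint' : ∀ j, Integrable fun ξ => Real.Lp.fourierTransformInv (flux j f) ξ * ψ j ξ :=
    fun j => (ψ j).integrable.bdd_mul
      (Real.Lp.fourierTransformInv _).continuous.aestronglyMeasurable
      (.of_forall (norm_fourierTransformInv_le _))
  calc transportPairing f (𝓕⁻ χ) = ∫ x, ∑ j, flux j f x * 𝓕⁻ (ψ j) x := by
        refine integral_congr_ae ?_
        filter_upwards [coeFn_flux 0 f, coeFn_flux 1 f] with x h₀ h₁
        simp only [Fin.sum_univ_two, hderiv, h₀, h₁]
        ring
    _ = ∫ ξ, ∑ j, Real.Lp.fourierTransformInv (flux j f) ξ * ψ j ξ := by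
        rw [integral_finsetSum _ fun j _ => hint j, integral_finsetSum _ fun j _ => hint' j]
        simp only [integral_mul_fourierInv_eq]
    _ = ∫ ξ, transportSymbol f ξ * χ ξ := by
        simp only [transportSymbol, Finset.sum_mul, hψ]
        congr! 3
        ring

end Transport

section Weight

lemma norm_sq_linearFlow_const_mul_norm {V : Type*} [NormedAddCommGroup V] (m : V → ℝ) (C τ : ℝ)
    (ξ : V) : ‖linearFlow m (fun ξ => C * ‖ξ‖) τ ξ‖ ^ 2 =
      C ^ 2 * (‖ξ‖ ^ 2 * Real.exp (-(2 * τ * m ξ))) := by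
  have hexp : Real.exp (-(2 * τ * m ξ)) = Real.exp (-(m ξ * τ)) ^ 2 := by
    rw [← Real.exp_nat_mul]
    ring_nf
  rw [linearFlow, smul_eq_mul, Real.norm_eq_abs, sq_abs, hexp]
  ring

variable {α β : ℝ}

lemma memLp_linearFlow_const_mul_norm (hα : 0 < α) (hβ : 0 < β) (C : ℝ) {τ : ℝ} (hτ : 0 < τ) :
    MemLp (linearFlow (dissipationSymbol α β) (fun ξ => C * ‖ξ‖) τ) 2 volume := by
  have hm := (continuous_dissipationSymbol hα.le hβ.le).measurable
  have hw : Continuous fun ξ : Plane => C * ‖ξ‖ := by fun_prop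
  rw [memLp_two_iff_integrable_sq_norm
    (aestronglyMeasurable_linearFlow_apply hm hw.aestronglyMeasurable τ)]
  simp only [norm_sq_linearFlow_const_mul_norm]
  exact (integrable_norm_sq_mul_exp_dissipationSymbol hα hβ (by positivity)).const_mul _

lemma exists_energy_linearFlow_const_mul_norm_le (hα : 0 < α) (hβ : 0 < β) (C : ℝ) :
    ∃ c, 0 ≤ c ∧ ∀ τ ≥ 1,
      energy volume (linearFlow (dissipationSymbol α β) (fun ξ : Plane => C * ‖ξ‖) τ) ≤
        c * τ ^ (-(min (α + 3 * β) (3 * α + β) / (2 * α * β))) := by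
  obtain ⟨c, hc, hle⟩ := exists_integral_norm_sq_mul_exp_dissipationSymbol_le hα hβ
  refine ⟨C ^ 2 * c, by positivity, fun τ hτ => ?_⟩
  have hexponent : -(min (α + 3 * β) (3 * α + β) / (2 * α * β)) ≤ 0 :=
    neg_nonpos.mpr (by positivity)
  calc energy volume (linearFlow (dissipationSymbol α β) (fun ξ : Plane => C * ‖ξ‖) τ)
      = C ^ 2 * ∫ ξ : Plane, ‖ξ‖ ^ 2 * Real.exp (-(2 * τ * dissipationSymbol α β ξ)) := by
        simp only [energy, norm_sq_linearFlow_const_mul_norm, integral_const_mul]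
    _ ≤ C ^ 2 * (c * (2 * τ) ^ (-(min (α + 3 * β) (3 * α + β) / (2 * α * β)))) := by
        gcongr
        exact hle _ (by linarith)
    _ ≤ C ^ 2 * (c * τ ^ (-(min (α + 3 * β) (3 * α + β) / (2 * α * β)))) := by
        gcongr C ^ 2 * (c * ?_)
        exact Real.rpow_le_rpow_of_nonpos (by linarith) (by linarith) hexponent
    _ = _ := by ring

end Weight

lemma hasEnergyInequality_of_lintegral_le {Ω F : Type*} [MeasurableSpace Ω] [NormedAddCommGroup F]
    {μ : Measure Ω} [SFinite μ] {m : Ω → ℝ} {X : ℝ → Ω → F} {s t : ℝ} (hm : Measurable m)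
    (hm0 : ∀ ξ, 0 ≤ m ξ) (hX : AEStronglyMeasurable (Function.uncurry X) (slab μ s t))
    (h : ENNReal.ofReal (energy μ (X t)) +
        2 * ∫⁻ τ in Set.Ioc s t, ∫⁻ ξ, ENNReal.ofReal (m ξ * ‖X τ ξ‖ ^ 2) ∂μ ≤
      ENNReal.ofReal (energy μ (X s))) : HasEnergyInequality μ m X 0 s t := by
  have hmeas : AEStronglyMeasurable (fun p : ℝ × Ω => m p.2 * ‖X p.1 p.2‖ ^ 2) (slab μ s t) :=
    (hm.comp measurable_snd).aestronglyMeasurable.mul (hX.norm.pow 2)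
  have hnonneg (p : ℝ × Ω) : 0 ≤ m p.2 * ‖X p.1 p.2‖ ^ 2 := mul_nonneg (hm0 _) (sq_nonneg _)
  rw [← lintegral_prod (fun p : ℝ × Ω => ENNReal.ofReal (m p.2 * ‖X p.1 p.2‖ ^ 2))
    hmeas.aemeasurable.ennreal_ofReal] at h
  have hint : Integrable (fun p : ℝ × Ω => m p.2 * ‖X p.1 p.2‖ ^ 2) (slab μ s t) := by
    refine ⟨hmeas, (hasFiniteIntegral_iff_ofReal (.of_forall hnonneg)).mpr ?_⟩
    refine ENNReal.lt_top_of_mul_ne_top_right ?_ two_ne_zero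
    exact ne_top_of_le_ne_top ENNReal.ofReal_ne_top (le_add_self.trans h)
  refine ⟨hint, ?_⟩
  rw [← ofReal_integral_eq_lintegral_ofReal hint (.of_forall hnonneg), ← ENNReal.ofReal_ofNat,
    ← ENNReal.ofReal_mul zero_le_two, ← ENNReal.ofReal_add (energy_nonneg μ _)
      (mul_nonneg zero_le_two (integral_nonneg hnonneg)),
    ENNReal.ofReal_le_ofReal_iff (energy_nonneg μ _)] at h
  rwa [add_zero]

section Transfer

variable {α β : ℝ} {θ₀ : RealL2} {θ : ℝ → RealL2}

lemma IsWeakSolution.norm_le (hθ : IsWeakSolution α β θ₀ θ) {t : ℝ} (ht : 0 ≤ t) :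
    ‖θ t‖ ≤ ‖θ₀‖ := by
  have hsq : ‖θ t‖ₑ ^ 2 ≤ ‖θ₀‖ₑ ^ 2 := (self_le_add_right _ _).trans (hθ.energy_zero t ht)
  exact enorm_le_iff_norm_le.mp ((ENNReal.pow_le_pow_left_iff two_ne_zero).mp hsq)

lemma IsWeakSolution.exists_modification (hθ : IsWeakSolution α β θ₀ θ) :
    ∃ Θ : ℝ → RealL2, StronglyMeasurable Θ ∧ (∀ s, ‖Θ s‖ ≤ ‖θ₀‖) ∧
      θ =ᵐ[volume.restrict (Set.Ioi (0 : ℝ))] Θ := by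
  have hmk := hθ.measurable.stronglyMeasurable_mk
  set S := {s | ‖hθ.measurable.mk θ s‖ ≤ ‖θ₀‖}
  refine ⟨S.indicator (hθ.measurable.mk θ),
    hmk.indicator (measurableSet_le hmk.norm.measurable measurable_const), fun s => ?_, ?_⟩
  · rw [Set.indicator_apply]
    split_ifs with hs
    exacts [hs, norm_zero.trans_le (norm_nonneg _)]
  · filter_upwards [hθ.measurable.ae_eq_mk, ae_restrict_mem measurableSet_Ioi] with s hs hpos
    have hmem : s ∈ S := by
      change ‖hθ.measurable.mk θ s‖ ≤ ‖θ₀‖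
      exact hs ▸ hθ.norm_le (Set.mem_Ioi.mp hpos).le
    rw [Set.indicator_of_mem hmem, hs]

lemma isForcing_transportSymbol {Θ : ℝ → RealL2} (hΘ : StronglyMeasurable Θ) {A : ℝ}
    (hA : ∀ s, ‖Θ s‖ ≤ A) :
    IsForcing (fun ξ => 4 * Real.pi * A ^ 2 * ‖ξ‖) fun s => transportSymbol (Θ s) where
  stronglyMeasurable := continuous_uncurry_transportSymbol.comp_stronglyMeasurable
    (f := fun p : ℝ × Plane => (Θ p.1, p.2))
    ((hΘ.comp_measurable measurable_fst).prodMk measurable_snd.stronglyMeasurable)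
  norm_le s ξ := (norm_transportSymbol_le _ _).trans (by gcongr; exact hA s)

lemma IsWeakSolution.isFourierSolution (hθ : IsWeakSolution α β θ₀ θ) (hα : 0 ≤ α) (hβ : 0 ≤ β)
    {Θ : ℝ → RealL2} (hΘ : θ =ᵐ[volume.restrict (Set.Ioi (0 : ℝ))] Θ) :
    IsFourierSolution volume (dissipationSymbol α β) (fun s => transportSymbol (Θ s))
      (conjFourier θ₀) fun t => conjFourier (θ t) where
  measurable := conjFourier.continuous.comp_aestronglyMeasurable hθ.measurable
  locally_bounded T := ⟨‖θ₀‖, fun t ht => (norm_conjFourier _).trans_le (hθ.norm_le ht.1)⟩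
  equation χ t ht := by
    have h := hθ.equation (𝓕⁻ χ) t ht
    rw [integral_ofReal_mul_fourierInv, integral_ofReal_mul_fourierInv] at h
    rw [h]
    refine intervalIntegral.integral_congr_ae ?_
    filter_upwards [(ae_restrict_iff' measurableSet_Ioi).mp hΘ] with s hs hmem
    rw [Set.uIoc_of_le ht] at hmem
    rw [transportPairing_fourierInv, dissipationPairing_fourierInv hα hβ, hs hmem.1]

lemma IsLinearSolution.isFourierSolution (hθ : IsLinearSolution α β θ₀ θ) (hα : 0 ≤ α)
    (hβ : 0 ≤ β) : IsFourierSolution volume (dissipationSymbol α β) 0 (conjFourier θ₀)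
      fun t => conjFourier (θ t) where
  measurable := conjFourier.continuous.comp_aestronglyMeasurable hθ.measurable
  locally_bounded T := by
    simpa only [norm_conjFourier] using hθ.locally_bounded T
  equation χ t ht := by
    have h := hθ.equation (𝓕⁻ χ) t ht
    rw [integral_ofReal_mul_fourierInv, integral_ofReal_mul_fourierInv] at h
    rw [h, ← intervalIntegral.integral_neg]
    simp only [dissipationPairing_fourierInv hα hβ, Pi.zero_apply, zero_mul, integral_zero,
      zero_sub]

lemma IsLinearSolution.ae_eq_linearFlow (hθ : IsLinearSolution α β θ₀ θ) (hα : 0 ≤ α)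
    (hβ : 0 ≤ β) {t : ℝ} (ht : 0 ≤ t) :
    conjFourier (θ t) =ᵐ[volume] linearFlow (dissipationSymbol α β) (conjFourier θ₀) t := by
  have hzero : IsForcing (0 : Plane → ℝ) (0 : ℝ → Plane → ℂ) :=
    ⟨stronglyMeasurable_zero, fun _ _ => norm_zero.le⟩
  refine ((hθ.isFourierSolution hα hβ).ae_eq_duhamel hzero (continuous_dissipationSymbol hα hβ)
    (dissipationSymbol_nonneg α β) continuous_zero ht).trans ?_
  exact .of_forall (duhamel_zero_forcing t)

lemma enorm_sq_eq_ofReal_energy {f : RealL2} {V : Plane → ℂ} (hV : conjFourier f =ᵐ[volume] V) :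
    ‖f‖ₑ ^ 2 = ENNReal.ofReal (energy volume V) := by
  rw [← energy_congr hV, energy_coeFn, norm_conjFourier, ENNReal.ofReal_pow (norm_nonneg _),
    ofReal_norm]

lemma absDerivSymbol_nonneg (j : Fin 2) (s : ℝ) (ξ : Plane) : 0 ≤ absDerivSymbol j s ξ := by
  unfold absDerivSymbol
  positivity

lemma absDerivNormSq_eq_lintegral (j : Fin 2) (s : ℝ) {f : RealL2} {V : Plane → ℂ}
    (hV : conjFourier f =ᵐ[volume] V) :
    absDerivNormSq j s f =
      ∫⁻ ξ, ENNReal.ofReal (absDerivSymbol j (2 * s) ξ * ‖V ξ‖ ^ 2) := by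
  refine lintegral_congr_ae ?_
  filter_upwards [hV, coeFn_conjFourier f] with ξ hVξ hconj
  have hnorm : ‖V ξ‖ = ‖(𝓕 (toComplex f) : ComplexL2) ξ‖ := by rw [← hVξ, hconj, norm_star]
  have hsq : absDerivSymbol j (2 * s) ξ = absDerivSymbol j s ξ ^ 2 := by
    rw [absDerivSymbol, absDerivSymbol, mul_comm 2 s, Real.rpow_mul (by positivity),
      Real.rpow_two]
  rw [hnorm, hsq, ← mul_pow, ENNReal.ofReal_pow (mul_nonneg (absDerivSymbol_nonneg j s ξ)
    (norm_nonneg _)), ← ofReal_norm, norm_mul, Complex.norm_real,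
    Real.norm_of_nonneg (absDerivSymbol_nonneg j s ξ)]

lemma absDerivNormSq_add (α β : ℝ) {f : RealL2} {V : Plane → ℂ}
    (hV : conjFourier f =ᵐ[volume] V) :
    absDerivNormSq 0 α f + absDerivNormSq 1 β f =
      ∫⁻ ξ, ENNReal.ofReal (dissipationSymbol α β ξ * ‖V ξ‖ ^ 2) := by
  have hVm : AEStronglyMeasurable V volume := (Lp.aestronglyMeasurable (conjFourier f)).congr hV
  have hmeas : AEMeasurable (fun ξ => absDerivSymbol 0 (2 * α) ξ * ‖V ξ‖ ^ 2) volume :=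
    (measurable_absDerivSymbol 0 (2 * α)).aemeasurable.mul (hVm.norm.aemeasurable.pow_const 2)
  have hnonneg (j : Fin 2) (s : ℝ) (ξ : Plane) : 0 ≤ absDerivSymbol j s ξ * ‖V ξ‖ ^ 2 :=
    mul_nonneg (absDerivSymbol_nonneg j s ξ) (sq_nonneg _)
  rw [absDerivNormSq_eq_lintegral 0 α hV, absDerivNormSq_eq_lintegral 1 β hV,
    ← lintegral_add_left' hmeas.ennreal_ofReal]
  refine lintegral_congr fun ξ => ?_
  rw [← ENNReal.ofReal_add (hnonneg _ _ _) (hnonneg _ _ _), ← add_mul, dissipationSymbol]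

lemma IsWeakSolution.exists_isLerayForcing (hθ : IsWeakSolution α β θ₀ θ) (hα : 0 ≤ α)
    (hβ : 0 ≤ β) :
    ∃ N, IsLerayForcing volume (dissipationSymbol α β) (fun ξ => 4 * Real.pi * ‖θ₀‖ ^ 2 * ‖ξ‖)
        (conjFourier θ₀) N ∧ ∀ t ≥ 0,
      conjFourier (θ t) =ᵐ[volume] duhamel (dissipationSymbol α β) N (conjFourier θ₀) t := by
  obtain ⟨Θ, hΘm, hΘle, hΘ⟩ := hθ.exists_modification
  have hm := continuous_dissipationSymbol hα hβ
  have hm0 := dissipationSymbol_nonneg α β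
  have hN := isForcing_transportSymbol hΘm hΘle
  have hV (t : ℝ) (ht : 0 ≤ t) := (hθ.isFourierSolution hα hβ hΘ).ae_eq_duhamel hN hm hm0
    (continuous_const.mul continuous_norm) ht
  refine ⟨_, { hN with
    memLp := fun t ht => (Lp.memLp (conjFourier (θ t))).ae_eq (hV t ht)
    energy_le := fun t ht => ?_
    energy_ae := ?_ }, hV⟩
  · rw [← energy_congr (hV t ht), energy_coeFn, energy_coeFn, norm_conjFourier, norm_conjFourier]
    gcongr
    exact hθ.norm_le ht
  · filter_upwards [hθ.energy_ae, ae_restrict_mem measurableSet_Ioi] with s hs hpos t hst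
    have hs0 : 0 ≤ s := (Set.mem_Ioi.mp hpos).le
    have h := hs t hst
    rw [enorm_sq_eq_ofReal_energy (hV t (hs0.trans hst)), enorm_sq_eq_ofReal_energy (hV s hs0),
      setLIntegral_congr_fun measurableSet_Ioc fun τ hτ =>
        absDerivNormSq_add α β (hV τ (hs0.trans hτ.1.le))] at h
    exact hasEnergyInequality_of_lintegral_le hm.measurable hm0
      (hN.aestronglyMeasurable_duhamel hm.measurable (Lp.aestronglyMeasurable _) _) h

lemma norm_sub_sq_eq_energy_duhamel_zero {f g f₀ : RealL2} {m : Plane → ℝ} {N : ℝ → Plane → ℂ}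
    {t : ℝ} (hf : conjFourier f =ᵐ[volume] duhamel m N (conjFourier f₀) t)
    (hg : conjFourier g =ᵐ[volume] linearFlow m (conjFourier f₀) t) :
    ‖f - g‖ ^ 2 = energy volume (duhamel m N 0 t) := by
  rw [← norm_conjFourier, ← energy_coeFn, map_sub]
  refine energy_congr ?_
  filter_upwards [Lp.coeFn_sub (conjFourier f) (conjFourier g), hf, hg] with ξ hsub hfξ hgξ
  rw [hsub, Pi.sub_apply, hfξ, hgξ, duhamel_eq_add (X₀ := conjFourier f₀), add_sub_cancel_left]

lemma le_sqrt_mul_rpow_of_sq_le {x y M γ : ℝ} (hy : 0 ≤ y) (h : x ^ 2 ≤ M * y ^ (-γ)) :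
    x ≤ √M * y ^ (-(γ / 2)) :=
  calc x ≤ √(M * y ^ (-γ)) := Real.le_sqrt_of_sq_le h
    _ = √M * y ^ (-(γ / 2)) := by
      rw [Real.sqrt_mul' _ (Real.rpow_nonneg hy _), Real.sqrt_eq_rpow (y ^ _), ← Real.rpow_mul hy]
      ring_nf

end Transfer

end AnisoSQG

end

theorem theorem1p5 (α β : ℝ) (hα : 0 < α) (hβ : 0 < β)
    (hαβ : 4 * α * β < min (α + 3 * β) (3 * α + β)) (θ₀ : AnisoSQG.RealL2) :
    ∃ C₀ : ℝ, 0 < C₀ ∧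
      ∀ θ θlin : ℝ → AnisoSQG.RealL2,
        AnisoSQG.IsWeakSolution α β θ₀ θ → AnisoSQG.IsLinearSolution α β θ₀ θlin →
          ∀ t : ℝ, 0 ≤ t →
            ‖θ t - θlin t‖ ≤ C₀ * (1 + t) ^
              (-((min (α + 3 * β) (3 * α + β) - 4 * α * β) / (8 * α * β))) := by
  open AnisoSQG in
  set γ := (min (α + 3 * β) (3 * α + β) - 4 * α * β) / (4 * α * β) with hγ
  have hγ0 : 0 ≤ γ := div_nonneg (sub_nonneg.mpr hαβ.le) (by positivity)
  have hrate : min (α + 3 * β) (3 * α + β) / (2 * α * β) = 2 * γ + 2 := by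
    rw [hγ]
    field_simp
    ring
  obtain ⟨c, hc, hdecay⟩ :=
    exists_energy_linearFlow_const_mul_norm_le hα hβ (4 * Real.pi * ‖θ₀‖ ^ 2)
  rw [hrate] at hdecay
  obtain ⟨M, hM⟩ := exists_energy_duhamel_zero_le (X₀ := conjFourier θ₀)
    (continuous_dissipationSymbol hα.le hβ.le).measurable (dissipationSymbol_nonneg α β)
    (fun _ => memLp_linearFlow_const_mul_norm hα hβ _) hγ0 hc hdecay
  refine ⟨√M + 1, by positivity, fun θ θlin hθ hlin t ht => ?_⟩
  obtain ⟨N, hN, hV⟩ := hθ.exists_isLerayForcing hα.le hβ.le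
  have hsq : ‖θ t - θlin t‖ ^ 2 ≤ M * (1 + t) ^ (-γ) :=
    (norm_sub_sq_eq_energy_duhamel_zero (hV t ht) (hlin.ae_eq_linearFlow hα.le hβ.le ht)).trans_le
      (hM N hN t ht)
  calc ‖θ t - θlin t‖ ≤ √M * (1 + t) ^ (-(γ / 2)) := le_sqrt_mul_rpow_of_sq_le (by positivity) hsq
    _ ≤ (√M + 1) * (1 + t) ^ (-(γ / 2)) := by gcongr; exact le_add_of_nonneg_right zero_le_one
    _ = _ := by rw [hγ]; ring_nf
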